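/- Let $n\ge 0$ and let $\rho$ be a pure quantum Gaussian state of $2n$ bosonic modes, i.e. a rank-one projection $\rho=|\psi\rangle\langle\psi|$ on $L^2(\mathbb R^{2n})=L^2(\mathbb R^n)\otimes L^2(\mathbb R^n)$ whose characteristic function is Gaussian, $\operatorname{Tr}(\rho\,e^{i z\cdot R})=\exp(-\tfrac12 z^T\sigma z+i\,m\cdot z)$ for $z\in\mathbb R^{4n}$, where $R$ is the vector of the canonical observables (positions and momenta), $[R_j,R_k]=i\Delta_{jk}$, $m$ is a real vector and $\sigma$ is a real symmetric matrix, the covariance matrix of the state. Let $\Phi$ be an extreme bosonic Gaussian channel acting on $n$ modes: a quantum channel (a completely positive trace-preserving map, $\Phi(\tau)=\sum_k V_k\tau V_k^\dagger$ with $\sum_k V_k^\dagger V_k=1$) which - is Gaussian: there are $K,\alpha\in\mathbb R^{2n\times 2n}$ with $\alpha=\alpha^T$, and $d\in\mathbb R^{2n}$, such that $\operatorname{Tr}(\Phi(\tau)e^{iz\cdot R})=\operatorname{Tr}(\tau\,e^{i(K^Tz)\cdot R})\exp(-\tfrac12 z^T\alpha z+i\,d\cdot z)$ for every $n$-mode state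 $\tau$ and every $z\in\mathbb R^{2n}$; - is extreme: it cannot be written as a convex combination $\Phi=p\,\Phi_1+(1-p)\,\Phi_2$ with $0<p<1$ of two different quantum channels $\Phi_1\neq\Phi_2$. Then $(\mathbb 1\otimes\Phi)(\rho)$, where $\Phi$ acts on the last $n$ of the $2n$ modes, is a quantum Gaussian state, and at least half of the symplectic eigenvalues of its covariance matrix $\sigma'$ are equal to $1/2$: of the $2n$ symplectic eigenvalues (the moduli $\nu>0$ of the eigenvalues $\pm i\nu$ of $\sigma'\Delta^{-1}$, each pair counted once, with multiplicity) at least $n$ are equal to $1/2$. -/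

import Mathlib

open MeasureTheory
open scoped InnerProductSpace ENNReal Matrix

noncomputable section

namespace Bosonic

/-! ### The Hilbert space of a finite set of modes -/

/-- The Hilbert space `L²(ℝ^ι)` of a bosonic quantum system with set of modes `ι`. -/
abbrev ModeSpace (ι : Type) [Fintype ι] : Type :=
  Lp ℂ 2 (volume : Measure (ι → ℝ))

/-- Bounded operators on the Hilbert space of the modes `ι`. -/
abbrev ModeOp (ι : Type) [Fintype ι] : Type :=
  ModeSpace ι →L[ℂ] ModeSpace ι

/-! ### Weyl (displacement) operators -/

section Weyl

variable {ι : Type} [Fintype ι]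

theorem memLp_phase_mul {φ : (ι → ℝ) → ℂ} (hφ : Continuous φ) (h1 : ∀ x, ‖φ x‖ = 1)
    (f : ModeSpace ι) : MemLp (fun x => φ x * f x) 2 volume :=
  (Lp.memLp f).of_le (hφ.aestronglyMeasurable.mul (Lp.aestronglyMeasurable f))
    (Filter.Eventually.of_forall fun x => by simp [h1])

/-- Multiplication by a continuous function of modulus one, as an isometry of `L²(ℝ^ι)`. -/
def phaseMul (φ : (ι → ℝ) → ℂ) (hφ : Continuous φ) (h1 : ∀ x, ‖φ x‖ = 1) :
    ModeSpace ι →ₗᵢ[ℂ] ModeSpace ι where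
  toFun f := (memLp_phase_mul hφ h1 f).toLp _
  map_add' f g := by
    rw [← MemLp.toLp_add]
    refine MemLp.toLp_congr _ _ ?_
    filter_upwards [Lp.coeFn_add f g] with x hx
    rw [hx, Pi.add_apply, mul_add]
    rfl
  map_smul' c f := by
    rw [RingHom.id_apply, ← MemLp.toLp_const_smul]
    refine MemLp.toLp_congr _ _ ?_
    filter_upwards [Lp.coeFn_smul c f] with x hx
    rw [hx, Pi.smul_apply, smul_eq_mul, mul_left_comm]
    rfl
  norm_map' f := by
    change ‖(memLp_phase_mul hφ h1 f).toLp _‖ = ‖f‖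
    rw [Lp.norm_toLp, Lp.norm_def]
    congr 1
    refine eLpNorm_congr_norm_ae (Filter.Eventually.of_forall fun x => by simp [h1])

/-- The phase `x ↦ exp(i (a·x + a·b/2))` in the Weyl operator of `z = (a, b)`. -/
def weylPhase (z : ι ⊕ ι → ℝ) (x : ι → ℝ) : ℂ :=
  Complex.exp (((∑ j, z (.inl j) * (x j + z (.inr j) / 2) : ℝ) : ℂ) * Complex.I)

theorem continuous_weylPhase (z : ι ⊕ ι → ℝ) : Continuous (weylPhase z) := by
  unfold weylPhase
  fun_prop

theorem norm_weylPhase (z : ι ⊕ ι → ℝ) (x : ι → ℝ) : ‖weylPhase z x‖ = 1 :=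
  Complex.norm_exp_ofReal_mul_I _

/-- The Weyl (displacement) operator `W(z) = exp(i z·R)`, where `R = (q, p)` is the vector of the
canonical observables, `q_j` the multiplication by `x_j` and `p_j = -i ∂/∂x_j`, and `z = (a, b)`
with `a` in the `inl` and `b` in the `inr` coordinates:
`(W(z) f)(x) = exp(i (a·x + a·b/2)) f(x + b)`. -/
def weyl (z : ι ⊕ ι → ℝ) : ModeOp ι :=
  ((phaseMul (weylPhase z) (continuous_weylPhase z) (norm_weylPhase z)).comp
    (Lp.compMeasurePreservingₗᵢ ℂ (fun x : ι → ℝ => x + fun j => z (.inr j))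
      (measurePreserving_add_right volume _))).toContinuousLinearMap

theorem weyl_apply_ae (z : ι ⊕ ι → ℝ) (f : ModeSpace ι) :
    ∀ᵐ x : ι → ℝ, weyl z f x =
      Complex.exp (((∑ j, z (.inl j) * (x j + z (.inr j) / 2) : ℝ) : ℂ) * Complex.I) *
        f (x + fun j => z (.inr j)) := by
  have h1 := MemLp.coeFn_toLp (memLp_phase_mul (continuous_weylPhase z) (norm_weylPhase z)
    (Lp.compMeasurePreserving (fun x : ι → ℝ => x + fun j => z (.inr j))
      (measurePreserving_add_right volume _) f))
  have h2 := Lp.coeFn_compMeasurePreserving f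
    (measurePreserving_add_right (volume : Measure (ι → ℝ)) (fun j => z (.inr j)))
  filter_upwards [h1, h2] with x hx1 hx2
  refine hx1.trans ?_
  rw [hx2]
  rfl

end Weyl

/-! ### States -/

section States

variable {ι : Type} [Fintype ι]

/-- The index set of a fixed Hilbert basis. -/
def basisIndex (ι : Type) [Fintype ι] : Set (ModeSpace ι) :=
  Classical.choose (exists_hilbertBasis ℂ (ModeSpace ι))

/-- A fixed Hilbert basis of `L²(ℝ^ι)`, used to compute traces. -/
def basis (ι : Type) [Fintype ι] : HilbertBasis (basisIndex ι) ℂ (ModeSpace ι) :=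
  Classical.choose (Classical.choose_spec (exists_hilbertBasis ℂ (ModeSpace ι)))

/-- The trace `Tr T = ∑ i, ⟨e_i, T e_i⟩` (it is only used for trace class operators, for which it
does not depend on the Hilbert basis). -/
def trace (T : ModeOp ι) : ℂ :=
  ∑' i, ⟪basis ι i, T (basis ι i)⟫_ℂ

/-- Density operators (quantum states): positive operators of trace one. -/
def IsDensityOperator (ρ : ModeOp ι) : Prop :=
  ρ.IsPositive ∧ HasSum (fun i => ⟪basis ι i, ρ (basis ι i)⟫_ℂ) 1

/-- Pure states: the orthogonal projections `|ψ⟩⟨ψ|` on unit vectors. -/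
def IsPureState (ρ : ModeOp ι) : Prop :=
  ∃ ψ : ModeSpace ι, ‖ψ‖ = 1 ∧ ρ = InnerProductSpace.rankOne ℂ ψ ψ

/-- The characteristic function `χ_ρ(z) = Tr(ρ W(z)) = Tr(ρ exp(i z·R))`. -/
def charFn (ρ : ModeOp ι) (z : ι ⊕ ι → ℝ) : ℂ :=
  trace (ρ ∘L weyl z)

/-- The Gaussian function `exp(-½ zᵀ σ z + i m·z)` on phase space. -/
def gaussianFn (m : ι ⊕ ι → ℝ) (σ : Matrix (ι ⊕ ι) (ι ⊕ ι) ℝ) (z : ι ⊕ ι → ℝ) : ℂ :=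
  Complex.exp (-(((z ⬝ᵥ σ *ᵥ z : ℝ) : ℂ) / 2) + ((m ⬝ᵥ z : ℝ) : ℂ) * Complex.I)

/-- `ρ` is the quantum Gaussian state with first moments `m` and covariance matrix `σ`: for every
`z` the observable `z·R` is normally distributed in `ρ` with mean `m·z` and variance `zᵀ σ z`,
i.e. `Tr(ρ exp(i z·R)) = exp(-½ zᵀ σ z + i m·z)`. As `σ` is symmetric, `m` and `σ` are determined
by `ρ`, and `σ_jk = ½ Tr(ρ {R_j - m_j, R_k - m_k})`; the vacuum has `σ = I / 2`. -/
def IsGaussianState (ρ : ModeOp ι) (m : ι ⊕ ι → ℝ) (σ : Matrix (ι ⊕ ι) (ι ⊕ ι) ℝ) : Prop :=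
  IsDensityOperator ρ ∧ σ.IsSymm ∧ ∀ z, charFn ρ z = gaussianFn m σ z

end States

/-! ### Symplectic eigenvalues -/

section Symplectic

variable {ι : Type} [Fintype ι] [DecidableEq ι]

/-- The symplectic form: `[R_j, R_k] = i Δ_jk` for `R = (q, p)`. -/
def sympForm (ι : Type) [DecidableEq ι] : Matrix (ι ⊕ ι) (ι ⊕ ι) ℝ :=
  Matrix.fromBlocks 0 1 (-1) 0

/-- The symplectic eigenvalues of a covariance matrix `σ`, with multiplicity: the eigenvalues of
`σ Δ⁻¹` come in pairs `±iν` with `ν > 0`, and the symplectic eigenvalues are the moduli `ν`,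
each pair being counted once. -/
def symplecticEigenvalues (σ : Matrix (ι ⊕ ι) (ι ⊕ ι) ℝ) : Multiset ℝ :=
  (((((σ * (sympForm ι)⁻¹).map ((↑) : ℝ → ℂ)).charpoly).roots).filter
    (fun c => 0 < c.im)).map (fun c => ‖c‖)

end Symplectic

/-! ### Composite systems -/

section Tensor

variable {κ ι : Type} [Fintype κ] [Fintype ι]

/-- The splitting `ℝ^(κ ⊕ ι) → ℝ^κ × ℝ^ι` of the configuration space of a composite system. -/
def split (x : κ ⊕ ι → ℝ) : (κ → ℝ) × (ι → ℝ) :=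
  (fun k => x (.inl k), fun j => x (.inr j))

theorem measurePreserving_split :
    MeasurePreserving (split : (κ ⊕ ι → ℝ) → (κ → ℝ) × (ι → ℝ)) volume volume :=
  volume_measurePreserving_sumPiEquivProdPi (fun _ : κ ⊕ ι => ℝ)

theorem memLp_prod_mul (f : ModeSpace κ) (g : ModeSpace ι) :
    MemLp (fun p : (κ → ℝ) × (ι → ℝ) => f p.1 * g p.2) 2 volume := by
  have hm : AEStronglyMeasurable (fun p : (κ → ℝ) × (ι → ℝ) => f p.1 * g p.2) volume :=
    (Lp.aestronglyMeasurable f).comp_fst.mul (Lp.aestronglyMeasurable g).comp_snd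
  have hf := (memLp_two_iff_integrable_sq_norm (Lp.aestronglyMeasurable f)).1 (Lp.memLp f)
  have hg := (memLp_two_iff_integrable_sq_norm (Lp.aestronglyMeasurable g)).1 (Lp.memLp g)
  rw [memLp_two_iff_integrable_sq_norm hm]
  exact (hf.mul_prod hg).congr (Filter.Eventually.of_forall fun p => by simp [mul_pow])

theorem memLp_tensor (f : ModeSpace κ) (g : ModeSpace ι) :
    MemLp (fun x : κ ⊕ ι → ℝ => f (fun k => x (.inl k)) * g (fun j => x (.inr j))) 2 volume :=
  (memLp_prod_mul f g).comp_measurePreserving measurePreserving_split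

/-- The product vector `f ⊗ g`, i.e. the function `(x, y) ↦ f(x) g(y)`. -/
def tensor (f : ModeSpace κ) (g : ModeSpace ι) : ModeSpace (κ ⊕ ι) :=
  (memLp_tensor f g).toLp _

theorem tensor_apply_ae (f : ModeSpace κ) (g : ModeSpace ι) :
    ∀ᵐ x : κ ⊕ ι → ℝ, tensor f g x = f (fun k => x (.inl k)) * g (fun j => x (.inr j)) :=
  MemLp.coeFn_toLp (memLp_tensor f g)

theorem inner_tensor (f f' : ModeSpace κ) (g g' : ModeSpace ι) :
    ⟪tensor f g, tensor f' g'⟫_ℂ = ⟪f, f'⟫_ℂ * ⟪g, g'⟫_ℂ := by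
  have h : ⟪tensor f g, tensor f' g'⟫_ℂ = ∫ x : κ ⊕ ι → ℝ,
      (fun p : (κ → ℝ) × (ι → ℝ) => ⟪f p.1, f' p.1⟫_ℂ * ⟪g p.2, g' p.2⟫_ℂ)
        (MeasurableEquiv.sumPiEquivProdPi (fun _ : κ ⊕ ι => ℝ) x) := by
    rw [L2.inner_def]
    refine integral_congr_ae ?_
    filter_upwards [tensor_apply_ae f g, tensor_apply_ae f' g'] with x h1 h2
    rw [h1, h2]
    simp only [RCLike.inner_apply, map_mul]
    change _ = (f' (fun k => x (.inl k)) * _) * (g' (fun j => x (.inr j)) * _)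
    ring_nf
    rfl
  rw [h, L2.inner_def, L2.inner_def]
  refine ((volume_measurePreserving_sumPiEquivProdPi (fun _ : κ ⊕ ι => ℝ)).integral_comp'
    (fun p : (κ → ℝ) × (ι → ℝ) => ⟪f p.1, f' p.1⟫_ℂ * ⟪g p.2, g' p.2⟫_ℂ)).trans ?_
  exact integral_prod_mul (fun x => ⟪f x, f' x⟫_ℂ) (fun y => ⟪g y, g' y⟫_ℂ)

theorem norm_tensor (f : ModeSpace κ) (g : ModeSpace ι) : ‖tensor f g‖ = ‖f‖ * ‖g‖ := by
  have h := inner_tensor f f g g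
  simp only [inner_self_eq_norm_sq_to_K] at h
  norm_cast at h
  rw [← mul_pow] at h
  exact (pow_left_inj₀ (norm_nonneg _) (by positivity) two_ne_zero).1 h

theorem tensor_add_right (f : ModeSpace κ) (g g' : ModeSpace ι) :
    tensor f (g + g') = tensor f g + tensor f g' := by
  rw [← sub_eq_zero, ← inner_self_eq_zero (𝕜 := ℂ)]
  simp only [inner_sub_left, inner_sub_right, inner_add_left, inner_add_right, inner_tensor]
  ring

theorem tensor_smul_right (c : ℂ) (f : ModeSpace κ) (g : ModeSpace ι) :
    tensor f (c • g) = c • tensor f g := by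
  rw [← sub_eq_zero, ← inner_self_eq_zero (𝕜 := ℂ)]
  simp only [inner_sub_left, inner_sub_right, inner_smul_left, inner_smul_right, inner_tensor]
  ring

theorem tensor_add_left (f f' : ModeSpace κ) (g : ModeSpace ι) :
    tensor (f + f') g = tensor f g + tensor f' g := by
  rw [← sub_eq_zero, ← inner_self_eq_zero (𝕜 := ℂ)]
  simp only [inner_sub_left, inner_sub_right, inner_add_left, inner_add_right, inner_tensor]
  ring

theorem tensor_smul_left (c : ℂ) (f : ModeSpace κ) (g : ModeSpace ι) :
    tensor (c • f) g = c • tensor f g := by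
  rw [← sub_eq_zero, ← inner_self_eq_zero (𝕜 := ℂ)]
  simp only [inner_sub_left, inner_sub_right, inner_smul_left, inner_smul_right, inner_tensor]
  ring

/-- The product vector as a continuous linear function of the first factor. -/
def tensorFlip (κ : Type) [Fintype κ] (g : ModeSpace ι) :
    ModeSpace κ →L[ℂ] ModeSpace (κ ⊕ ι) :=
  LinearMap.mkContinuous
    { toFun := fun f => tensor f g
      map_add' := fun f f' => tensor_add_left f f' g
      map_smul' := fun c f => tensor_smul_left c f g }
    ‖g‖ (fun f => by simp [norm_tensor, mul_comm])

/-- The isometry `g ↦ e ⊗ g` for a unit vector `e`. -/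
def tensorIsometry (ι : Type) [Fintype ι] (e : ModeSpace κ) (he : ‖e‖ = 1) :
    ModeSpace ι →ₗᵢ[ℂ] ModeSpace (κ ⊕ ι) where
  toFun g := tensor e g
  map_add' g g' := tensor_add_right e g g'
  map_smul' c g := tensor_smul_right c e g
  norm_map' g := by
    change ‖tensor e g‖ = ‖g‖
    rw [norm_tensor, he, one_mul]

theorem orthogonalFamily_tensor (κ ι : Type) [Fintype κ] [Fintype ι] :
    OrthogonalFamily ℂ (fun _ : basisIndex κ => ModeSpace ι)
      (fun i => tensorIsometry ι (basis κ i) ((basis κ).orthonormal.1 i)) := by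
  intro i j hij v w
  change ⟪tensor _ _, tensor _ _⟫_ℂ = 0
  rw [inner_tensor, (basis κ).orthonormal.2 hij, zero_mul]

/-- The identification of `ℓ²(ModeSpace ι)`, i.e. `ℓ² ⊗ L²(ℝ^ι)`, with `L²(ℝ^(κ ⊕ ι))` given by
`(g_i) ↦ ∑ i, e_i ⊗ g_i` for the fixed Hilbert basis `e` of `L²(ℝ^κ)`. -/
def ampIsometry (κ ι : Type) [Fintype κ] [Fintype ι] :
    lp (fun _ : basisIndex κ => ModeSpace ι) 2 →ₗᵢ[ℂ] ModeSpace (κ ⊕ ι) :=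
  (orthogonalFamily_tensor κ ι).linearIsometry

/-- The operator `1 ⊗ V` on `L²(ℝ^(κ ⊕ ι))`, for an operator `V` on `L²(ℝ^ι)`: it maps
`∑ i, e_i ⊗ g_i` to `∑ i, e_i ⊗ V g_i`. By `ampliation_tensor` it is the bounded operator with
`(1 ⊗ V)(f ⊗ g) = f ⊗ V g` for all `f` and `g`. -/
def ampliation (κ : Type) [Fintype κ] (V : ModeOp ι) : ModeOp (κ ⊕ ι) :=
  (ampIsometry κ ι).toContinuousLinearMap ∘L
    (lp.mapCLM 2 (fun _ : basisIndex κ => V) (norm_nonneg V) (fun _ => le_rfl)) ∘L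
      (ContinuousLinearMap.adjoint (ampIsometry κ ι).toContinuousLinearMap)

theorem exists_coords (f : ModeSpace κ) (g : ModeSpace ι) :
    ∃ c : lp (fun _ : basisIndex κ => ModeSpace ι) 2,
      (∀ i, c i = ⟪basis κ i, f⟫_ℂ • g) ∧ ampIsometry κ ι c = tensor f g := by
  have hm : Memℓp (fun i : basisIndex κ => ⟪basis κ i, f⟫_ℂ • g) 2 := by
    have h := lp.memℓp ((basis κ).repr f)
    rw [memℓp_gen_iff (by norm_num)] at h ⊢
    simp only [norm_smul, ENNReal.toReal_ofNat, Real.rpow_ofNat, mul_pow] at h ⊢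
    simp only [(basis κ).repr_apply_apply] at h
    exact h.mul_right _
  refine ⟨⟨_, hm⟩, fun i => rfl, ?_⟩
  have h1 := (orthogonalFamily_tensor κ ι).hasSum_linearIsometry ⟨_, hm⟩
  have h2 := ((basis κ).hasSum_repr f).mapL (tensorFlip κ g)
  refine h1.unique ?_
  convert! h2 using 2 with i
  change tensor _ (_ • g) = tensorFlip κ g (_ • _)
  rw [map_smul, (basis κ).repr_apply_apply, tensor_smul_right]
  rfl

theorem ampliation_tensor (V : ModeOp ι) (f : ModeSpace κ) (g : ModeSpace ι) :
    ampliation κ V (tensor f g) = tensor f (V g) := by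
  obtain ⟨c, hc, hc'⟩ := exists_coords f g
  obtain ⟨d, hd, hd'⟩ := exists_coords f (V g)
  rw [← hc', ← hd']
  have h : ContinuousLinearMap.adjoint (ampIsometry κ ι).toContinuousLinearMap
      (ampIsometry κ ι c) = c :=
    congrArg (fun T => T c) (LinearIsometry.adjoint_comp_self (ampIsometry κ ι))
  change ampIsometry κ ι (lp.mapCLM 2 (fun _ : basisIndex κ => V) (norm_nonneg V)
    (fun _ => le_rfl) (ContinuousLinearMap.adjoint
      (ampIsometry κ ι).toContinuousLinearMap (ampIsometry κ ι c))) = _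
  rw [h]
  congr 1
  ext1
  funext i
  rw [lp.mapCLM_apply_coe, hd, hc, map_smul]

end Tensor

/-! ### Quantum channels -/

section Channels

variable {ι : Type} [Fintype ι]

/-- A quantum channel (completely positive trace-preserving map) from the system with modes `ι` to
itself, given by an operator-sum representation: a sequence of bounded operators `V_k` with
`∑ k, V_k† V_k = 1`. Two such families describe the same channel if they have the same action
`QuantumChannel.apply` on density operators. -/
structure QuantumChannel (ι : Type) [Fintype ι] where
  kraus : ℕ → ModeOp ι
  complete : ∀ x : ModeSpace ι, HasSum (fun k => ‖kraus k x‖ ^ 2) (‖x‖ ^ 2)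

namespace QuantumChannel

/-- The action `Φ(ρ) = ∑ k, V_k ρ V_k†` of a channel on density operators. -/
def apply (Φ : QuantumChannel ι) (ρ : ModeOp ι) : ModeOp ι :=
  ∑' k, Φ.kraus k ∘L ρ ∘L ContinuousLinearMap.adjoint (Φ.kraus k)

/-- The action `(1 ⊗ Φ)(ρ) = ∑ k, (1 ⊗ V_k) ρ (1 ⊗ V_k)†` of a channel on the second part of a
bipartite state. -/
def applySnd (Φ : QuantumChannel ι) (κ : Type) [Fintype κ] (ρ : ModeOp (κ ⊕ ι)) :
    ModeOp (κ ⊕ ι) :=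
  ∑' k, ampliation κ (Φ.kraus k) ∘L ρ ∘L
    ContinuousLinearMap.adjoint (ampliation κ (Φ.kraus k))

/-- Bosonic Gaussian channels: for some real matrices `K` and `α = αᵀ` and some real vector `d`,
the channel acts on characteristic functions by
`χ_{Φ(ρ)}(z) = χ_ρ(Kᵀ z) exp(-½ zᵀ α z + i d·z)`; on Gaussian states, `σ ↦ K σ Kᵀ + α`. -/
def IsGaussian (Φ : QuantumChannel ι) : Prop :=
  ∃ (K α : Matrix (ι ⊕ ι) (ι ⊕ ι) ℝ) (d : ι ⊕ ι → ℝ), α.IsSymm ∧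
    ∀ ρ : ModeOp ι, IsDensityOperator ρ → ∀ z : ι ⊕ ι → ℝ,
      charFn (Φ.apply ρ) z = charFn ρ (Kᵀ *ᵥ z) * gaussianFn d α z

/-- Extreme channels: those that are not a non-trivial convex combination of two quantum
channels. -/
def IsExtreme (Φ : QuantumChannel ι) : Prop :=
  ∀ (Φ₁ Φ₂ : QuantumChannel ι) (p : ℝ), 0 < p → p < 1 →
    (∀ ρ : ModeOp ι, IsDensityOperator ρ →
      Φ.apply ρ = (p : ℂ) • Φ₁.apply ρ + ((1 - p : ℝ) : ℂ) • Φ₂.apply ρ) →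
    ∀ ρ : ModeOp ι, IsDensityOperator ρ → Φ₁.apply ρ = Φ₂.apply ρ

end QuantumChannel

end Channels

end Bosonic

end

/-!
Write `B(σ) = σ + ½ i Δ`. If `σ` is the covariance matrix of a Gaussian state of `N` modes, then
`B(σ) ≥ 0` is the uncertainty relation, and since `σ Δ⁻¹ - i/2` is the transpose of `B(σ)` times an
invertible matrix, the symplectic eigenvalue `1/2` occurs at least `2 N - rank B(σ)` times
(`symplecticEigenvalues_spec`). So the output covariance matrix `σ' = (1 ⊕ K) σ (1 ⊕ K)ᵀ + 0 ⊕ α`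
has to satisfy `rank B(σ') ≤ 3 n`. Now `B(σ') = (1 ⊕ K) B(σ) (1 ⊕ K)ᵀ + 0 ⊕ C(α)` with
`C(α) = α + ½ i (Δ - K Δ Kᵀ)` (`hermMatrix_output`), and purity of the state gives
`rank B(σ) ≤ 2 n`, extremality of the channel gives `rank C(α) ≤ n`.

Both rank bounds are instances of one principle. Let `A`, `U` be representations of the Weyl
relations with forms `D`, `D'`, and let `V` be an isometry with `V† A(z) V = g(z) U(z)` for a
Gaussian function `g(z) = exp(-½ zᵀ α z + i d·z)`. For a channel, `V` is the Stinespring isometry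
into `ℓ² ⊗ L²(ℝⁿ)`, `A(z) = 1 ⊗ W(z)` and `U(z) = W(Kᵀ z)`; for a pure state `ψ`, it is the map
`1 ↦ ψ` from `ℂ`, with `A = W` and `U = 1`.
* `posSemidef_of_intertwiner`: the Gram kernel of the vectors `A(z) V U(-z) f` shows that the matrix
  `α + ½ i (D - D')` is positive semidefinite.
* If its rank exceeds half its size, then its range meets the complex conjugate of its range, hence
  contains a real vector, and a form `λ λᵀ` with `λ ≠ 0` real can be subtracted from `α` without
  losing positivity (`exists_sub_vecMulVec_posSemidef`).
* `exists_commutant_of_intertwiner`: then `g` is a Gaussian average over `s` of the functions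
  `exp(½ (λ·z)²) g(z) exp(i s λ·z)`, each of which belongs to a positive kernel. Weighting the
  average with the density `½ (1 + cos s)` gives a kernel dominated by the Gram kernel, and its
  Radon–Nikodym derivative `0 ≤ T ≤ 1` commutes with all `A(z)` and satisfies
  `V† T A(z) V = ½ (1 + exp(-½) cosh(λ·z)) V† A(z) V`.
* The Weyl operators act irreducibly (`exists_eq_smul_of_commute_weyl`). For a pure state, `T` is
  therefore a scalar. For a channel, `T` commutes with all operators `1 ⊗ X`, so `√T V` and
  `√(1 - T) V` are, after normalization, Stinespring isometries of channels of which `Φ` is a convex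
  combination (`QuantumChannel.IsExtreme.inner_commutant`). In both cases the factor
  `½ (1 + exp(-½) cosh(λ·z))` would have to be constant in `z` (`rank_le_of_intertwiner`).

That `1 ⊗ Φ` acts on characteristic functions as expected is checked on product vectors, which are
total because the projection onto their complement commutes with the irreducible Weyl operators
(`eq_zero_of_inner_tensor`).
-/

noncomputable section

namespace Bosonic

/-! ### Positive semidefinite kernels -/

section Kernels

open scoped ComplexOrder
open Filter Topology

variable {X : Type*}

theorem posSemidef_of_tendsto {F : ℕ → Matrix X X ℂ} {M : Matrix X X ℂ}
    (hF : ∀ n, (F n).PosSemidef) (h : ∀ i j, Tendsto (fun n => F n i j) atTop (𝓝 (M i j))) :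
    M.PosSemidef := by
  refine ⟨?_, fun x => ?_⟩
  · ext i j
    refine tendsto_nhds_unique ?_ (h i j)
    have := (Complex.continuous_conj.tendsto _).comp (h j i)
    refine this.congr fun n => ?_
    exact (hF n).1.apply i j
  · refine ge_of_tendsto' (f := fun n => x.sum fun i xi => x.sum fun j xj => star xi * F n i j * xj)
      (x := atTop) ?_ fun n => (hF n).2 x
    refine tendsto_finsetSum _ fun i _ => tendsto_finsetSum _ fun j _ => ?_
    exact (tendsto_const_nhds.mul (h i j)).mul tendsto_const_nhds

theorem posSemidef_congr {M N : Matrix X X ℂ} (hN : N.PosSemidef) (h : ∀ i j, M i j = N i j) :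
    M.PosSemidef := by
  have : M = N := Matrix.ext h
  rwa [this]

theorem finsupp_sum_gram {E : Type*} [NormedAddCommGroup E] [InnerProductSpace ℂ E] (v : X → E)
    (c : X →₀ ℂ) :
    (c.sum fun i ci => c.sum fun j cj => star ci * ⟪v i, v j⟫_ℂ * cj) =
      ((‖Finsupp.linearCombination ℂ v c‖ ^ 2 : ℝ) : ℂ) := by
  have h := inner_self_eq_norm_sq_to_K (𝕜 := ℂ) (Finsupp.linearCombination ℂ v c)
  rw [Complex.ofReal_pow]
  refine Eq.trans ?_ h
  rw [Finsupp.linearCombination_apply, Finsupp.sum_inner]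
  refine Finsupp.sum_congr fun i _ => ?_
  rw [Finsupp.inner_sum]
  refine Finsupp.sum_congr fun j _ => ?_
  simp only [inner_smul_left, inner_smul_right, RCLike.star_def]
  ring

theorem posSemidef_gram {E : Type*} [NormedAddCommGroup E] [InnerProductSpace ℂ E] (v : X → E) :
    (Matrix.of fun i j => ⟪v i, v j⟫_ℂ).PosSemidef := by
  refine ⟨?_, fun c => ?_⟩
  · ext i j
    simp
  · simp only [Matrix.of_apply]
    rw [finsupp_sum_gram]
    exact Complex.zero_le_real.2 (by positivity)

theorem posSemidef_conj_mul (f : X → ℂ) :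
    (Matrix.of fun i j => starRingEnd ℂ (f i) * f j).PosSemidef := by
  have h := posSemidef_gram f
  simpa only [RCLike.inner_apply, mul_comm] using h

theorem posSemidef_pow {M : Matrix X X ℂ} (hM : M.PosSemidef) (k : ℕ) :
    (Matrix.of fun i j => M i j ^ k).PosSemidef := by
  induction k with
  | zero => simpa using posSemidef_conj_mul (fun _ : X => (1 : ℂ))
  | succ k ih =>
    have h : (Matrix.of fun i j => M i j ^ (k + 1)) = (Matrix.of fun i j => M i j ^ k) ⊙ M := by
      ext i j
      simp [pow_succ]
    rw [h]
    exact ih.hadamard hM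

/-- The entrywise exponential of a positive semidefinite kernel is positive semidefinite. -/
theorem posSemidef_cexp {M : Matrix X X ℂ} (hM : M.PosSemidef) :
    (Matrix.of fun i j => Complex.exp (M i j)).PosSemidef := by
  refine posSemidef_of_tendsto
    (F := fun n => ∑ k ∈ Finset.range n,
      ((k.factorial : ℝ)⁻¹ : ℝ) • (Matrix.of fun i j => M i j ^ k))
    (fun n => Matrix.posSemidef_sum _ fun k _ => (posSemidef_pow hM k).smul (by positivity)) ?_
  intro i j
  have h := (NormedSpace.expSeries_div_hasSum_exp (M i j)).tendsto_sum_nat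
  rw [← Complex.exp_eq_exp_ℂ] at h
  refine h.congr fun n => ?_
  rw [Matrix.sum_apply]
  refine Finset.sum_congr rfl fun k _ => ?_
  simp [div_eq_inv_mul]

/-- A nonnegative bounded density against a finite measure has a Fourier transform of positive
type. -/
theorem posSemidef_fourier (μ : Measure ℝ) [IsFiniteMeasure μ] (h : ℝ → ℝ) (hc : Continuous h)
    (h0 : ∀ s, 0 ≤ h s) (h1 : ∀ s, h s ≤ 1) :
    (Matrix.of fun x y : ℝ =>
      ∫ s, (h s : ℂ) * Complex.exp ((s * (y - x) : ℝ) * Complex.I) ∂μ).PosSemidef := by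
  have hint : ∀ x : ℝ,
      Integrable (fun s => (h s : ℂ) * Complex.exp ((s * x : ℝ) * Complex.I)) μ := by
    intro x
    refine Integrable.of_bound (C := 1) (by fun_prop) (ae_of_all _ fun s => ?_)
    rw [norm_mul, Complex.norm_exp_ofReal_mul_I, mul_one, Complex.norm_real, Real.norm_eq_abs,
      abs_of_nonneg (h0 s)]
    exact h1 s
  refine ⟨?_, fun c => ?_⟩
  · ext x y
    simp only [Matrix.conjTranspose_apply, Matrix.of_apply, RCLike.star_def]
    rw [← integral_conj]
    refine integral_congr_ae (ae_of_all _ fun s => ?_)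
    simp only [map_mul, Complex.conj_ofReal, ← Complex.exp_conj, Complex.conj_I]
    congr 2
    push_cast
    ring
  · have key : (c.sum fun x a => c.sum fun y b => star a *
        (∫ s, (h s : ℂ) * Complex.exp ((s * (y - x) : ℝ) * Complex.I) ∂μ) * b) =
        ∫ s, ((h s * ‖c.sum fun x a => Complex.exp ((s * x : ℝ) * Complex.I) * a‖ ^ 2 : ℝ) : ℂ)
          ∂μ := by
      simp only [Finsupp.sum]
      rw [integral_congr_ae (g := fun s => ∑ x ∈ c.support, ∑ y ∈ c.support, (starRingEnd ℂ (c x) *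
        ((h s : ℂ) * Complex.exp ((s * (y - x) : ℝ) * Complex.I)) * c y))]
      · rw [integral_finsetSum _ fun x _ => integrable_finsetSum _ fun y _ =>
          ((hint _).const_mul _).mul_const _]
        refine Finset.sum_congr rfl fun x _ => ?_
        rw [integral_finsetSum _ fun y _ => ((hint _).const_mul _).mul_const _]
        refine Finset.sum_congr rfl fun y _ => ?_
        rw [integral_mul_const, integral_const_mul]
        rfl
      · refine ae_of_all _ fun s => ?_
        simp only []
        rw [Complex.ofReal_mul, Complex.ofReal_pow, ← Complex.conj_mul', map_sum,
          Finset.sum_mul_sum, Finset.mul_sum]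
        refine Finset.sum_congr rfl fun x _ => ?_
        rw [Finset.mul_sum]
        refine Finset.sum_congr rfl fun y _ => ?_
        rw [map_mul, ← Complex.exp_conj]
        have : Complex.exp ((s * (y - x) : ℝ) * Complex.I) =
            Complex.exp ((starRingEnd ℂ) (((s * x : ℝ) : ℂ) * Complex.I)) *
              Complex.exp (((s * y : ℝ) : ℂ) * Complex.I) := by
          rw [← Complex.exp_add]
          congr 1
          simp only [map_mul, Complex.conj_ofReal, Complex.conj_I]
          push_cast
          ring
        rw [this]
        ring
    simp only [Matrix.of_apply]
    rw [key, integral_complex_ofReal]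
    exact Complex.zero_le_real.2 (integral_nonneg fun s => mul_nonneg (h0 s) (by positivity))

/-- A positive semidefinite scalar kernel is the Gram matrix of a family of vectors in a Hilbert
space. -/
theorem exists_gram_eq {X : Type} {τ : Matrix X X ℂ} (h : τ.PosSemidef) :
    ∃ (G : Type) (_ : NormedAddCommGroup G) (_ : InnerProductSpace ℂ G) (_ : CompleteSpace G)
      (u : X → G), ∀ x y, ⟪u x, u y⟫_ℂ = τ x y := by
  let K : Matrix X X (ℂ →L[ℂ] ℂ) := Matrix.of fun x y => τ x y • ContinuousLinearMap.id ℂ ℂ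
  have hK : K.PosSemidef := by
    have htfae := (RKHS.posSemidef_tfae (K := K)).out 0 2
    refine htfae.2 ⟨?_, fun c => ?_⟩
    · ext x y
      simp only [K, Matrix.conjTranspose_apply, Matrix.of_apply]
      rw [star_smul, h.1.apply]
      have : star (ContinuousLinearMap.id ℂ ℂ) = ContinuousLinearMap.id ℂ ℂ :=
        star_one (ℂ →L[ℂ] ℂ)
      rw [this]
    · refine (Complex.le_def.1 (h.2 c)).1.trans_eq ?_
      change Complex.re _ = Complex.re _
      congr 1
      simp only [Finsupp.sum]
      refine Finset.sum_congr rfl fun x _ => Finset.sum_congr rfl fun y _ => ?_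
      have h4 : (starRingEnd ℂ) (τ y x) = τ x y := h.1.apply x y
      simp [K, h4]
      ring
  have : Fact K.PosSemidef := ⟨hK⟩
  refine ⟨RKHS.OfKernel K, inferInstance, inferInstance, inferInstance,
    fun x => RKHS.kerFun (RKHS.OfKernel K) x 1, fun x y => ?_⟩
  have h2 := RKHS.kernel_inner (RKHS.OfKernel K) y x (1 : ℂ) (1 : ℂ)
  refine h2.symm.trans ?_
  have h3 : (starRingEnd ℂ) (τ y x) = τ x y := h.1.apply x y
  simp [K, h3]

/-- A positive kernel dominated by a Gram kernel is represented by an operator `0 ≤ T ≤ 1` (a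
Radon–Nikodym derivative), which vanishes on the orthogonal complement of the Gram vectors. -/
theorem exists_radonNikodym {X : Type} {H : Type*} [NormedAddCommGroup H] [InnerProductSpace ℂ H]
    [CompleteSpace H] (v : X → H) {τ : Matrix X X ℂ} (h0 : τ.PosSemidef)
    (h1 : ((Matrix.of fun i j => ⟪v i, v j⟫_ℂ) - τ).PosSemidef) :
    ∃ T : H →L[ℂ] H, 0 ≤ T ∧ T ≤ 1 ∧ (∀ x y, ⟪v x, T (v y)⟫_ℂ = τ x y) ∧
      ∀ w, (∀ x, ⟪v x, w⟫_ℂ = 0) → T w = 0 := by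
  obtain ⟨G, _, _, _, u, hu⟩ := exists_gram_eq h0
  let S : Submodule ℂ H := (LinearMap.range (Finsupp.linearCombination ℂ v)).topologicalClosure
  have hmem : ∀ c, Finsupp.linearCombination ℂ v c ∈ S := fun c =>
    Submodule.le_topologicalClosure _ ⟨c, rfl⟩
  have : CompleteSpace S := (Submodule.isClosed_topologicalClosure _).completeSpace_coe
  let e : (X →₀ ℂ) →ₗ[ℂ] S := (Finsupp.linearCombination ℂ v).codRestrict S hmem
  have hdense : DenseRange e := by
    rw [DenseRange, Subtype.dense_iff]
    intro x hx
    have h := Submodule.topologicalClosure_coe (LinearMap.range (Finsupp.linearCombination ℂ v))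
    have hx' : x ∈ closure (LinearMap.range (Finsupp.linearCombination ℂ v) : Set H) := by
      rw [← h]; exact hx
    refine closure_mono ?_ hx'
    rintro _ ⟨c, rfl⟩
    exact ⟨e c, ⟨c, rfl⟩, rfl⟩
  have hle : ∀ c, ‖Finsupp.linearCombination ℂ u c‖ ≤ 1 * ‖e c‖ := by
    intro c
    have h2 := h1.2 c
    have h3 : (c.sum fun i ci => c.sum fun j cj => star ci *
        ((Matrix.of fun i j => ⟪v i, v j⟫_ℂ) - τ) i j * cj) =
        ((‖Finsupp.linearCombination ℂ v c‖ ^ 2 -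
          ‖Finsupp.linearCombination ℂ u c‖ ^ 2 : ℝ) : ℂ) := by
      rw [Complex.ofReal_sub, ← finsupp_sum_gram, ← finsupp_sum_gram]
      simp only [hu, Finsupp.sum, Matrix.sub_apply, Matrix.of_apply, mul_sub, sub_mul,
        Finset.sum_sub_distrib]
    rw [h3, Complex.zero_le_real, sub_nonneg] at h2
    rw [one_mul]
    exact (sq_le_sq₀ (norm_nonneg _) (norm_nonneg _)).1 h2
  -- the contraction with `R v_x = u_x`, which exists because the kernel `τ` is dominated
  let R : H →L[ℂ] G := (LinearMap.extendOfNorm (Finsupp.linearCombination ℂ u) e) ∘L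
    S.orthogonalProjectionOnto
  have hR1 : ‖R‖ ≤ 1 := by
    refine (ContinuousLinearMap.opNorm_comp_le _ _).trans ?_
    exact mul_le_one₀ (LinearMap.opNorm_extendOfNorm_le hdense zero_le_one hle) (norm_nonneg _)
      (Submodule.orthogonalProjectionOnto_norm_le S)
  have hRv : ∀ x, R (v x) = u x := by
    intro x
    have hx : S.orthogonalProjectionOnto (v x) = e (Finsupp.single x 1) := by
      have hv : v x = ((e (Finsupp.single x 1) : S) : H) := by simp [e]
      rw [hv, Submodule.orthogonalProjectionOnto_mem_subspace_eq_self]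
    change (LinearMap.extendOfNorm (Finsupp.linearCombination ℂ u) e)
      (S.orthogonalProjectionOnto (v x)) = _
    rw [hx, LinearMap.extendOfNorm_eq hdense ⟨1, hle⟩]
    simp
  refine ⟨ContinuousLinearMap.adjoint R ∘L R, ?_, ?_, fun x y => ?_, fun w hw => ?_⟩
  · rw [ContinuousLinearMap.nonneg_iff_isPositive]
    exact ContinuousLinearMap.isPositive_adjoint_comp_self R
  · rw [ContinuousLinearMap.le_def, ContinuousLinearMap.isPositive_iff_complex]
    intro x
    have h2 : ⟪((1 : H →L[ℂ] H) - ContinuousLinearMap.adjoint R ∘L R) x, x⟫_ℂ =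
        ((‖x‖ ^ 2 - ‖R x‖ ^ 2 : ℝ) : ℂ) := by
      simp only [sub_apply, one_apply_eq_self,
        ContinuousLinearMap.comp_apply, inner_sub_left, ContinuousLinearMap.adjoint_inner_left,
        inner_self_eq_norm_sq_to_K]
      push_cast
      rfl
    rw [h2]
    refine ⟨rfl, ?_⟩
    change 0 ≤ ‖x‖ ^ 2 - ‖R x‖ ^ 2
    have h3 : ‖R x‖ ≤ ‖x‖ := (R.le_of_opNorm_le hR1 x).trans_eq (one_mul _)
    have := norm_nonneg (R x)
    nlinarith
  · rw [ContinuousLinearMap.comp_apply, ContinuousLinearMap.adjoint_inner_right, hRv, hRv, hu]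
  · have h2 : S.orthogonalProjectionOnto w = 0 := by
      rw [Submodule.orthogonalProjectionOnto_eq_zero_iff, Submodule.orthogonal_closure]
      rintro _ ⟨c, rfl⟩
      rw [Finsupp.linearCombination_apply, Finsupp.sum_inner]
      simp [hw, Finsupp.sum]
    simp [R, h2]

end Kernels

/-! ### Representations of the Weyl relations -/

section WeylSystems

open scoped ComplexOrder
open Filter Topology

variable {I : Type} [Fintype I]

/-- The phase `exp(-½ i zᵀ D w)` of the Weyl relations for the antisymmetric form `D`. -/
def cocycle (D : Matrix I I ℝ) (z w : I → ℝ) : ℂ :=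
  Complex.exp (-(((z ⬝ᵥ D *ᵥ w : ℝ) : ℂ) / 2 * Complex.I))

/-- A representation of the Weyl relations `A(z) A(w) = exp(-½ i zᵀ D w) A(z + w)` by unitary
operators, for an antisymmetric form `D` that may be degenerate. -/
structure IsWeylSystem {H : Type*} [NormedAddCommGroup H] [InnerProductSpace ℂ H] [CompleteSpace H]
    (D : Matrix I I ℝ) (A : (I → ℝ) → H →L[ℂ] H) : Prop where
  skew : Dᵀ = -D
  zero : A 0 = 1
  mul : ∀ z w x, A z (A w x) = cocycle D z w • A (z + w) x
  adjoint : ∀ z, ContinuousLinearMap.adjoint (A z) = A (-z)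

theorem skew_dotProduct {D : Matrix I I ℝ} (hD : Dᵀ = -D) (z w : I → ℝ) :
    w ⬝ᵥ D *ᵥ z = -(z ⬝ᵥ D *ᵥ w) := by
  rw [Matrix.dotProduct_mulVec, dotProduct_comm, ← Matrix.mulVec_transpose, hD, Matrix.neg_mulVec,
    dotProduct_neg]

theorem skew_dotProduct_self {D : Matrix I I ℝ} (hD : Dᵀ = -D) (z : I → ℝ) :
    z ⬝ᵥ D *ᵥ z = 0 := by
  have := skew_dotProduct hD z z
  linarith

namespace IsWeylSystem

variable {H : Type*} [NormedAddCommGroup H] [InnerProductSpace ℂ H] [CompleteSpace H]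
  {D : Matrix I I ℝ} {A : (I → ℝ) → H →L[ℂ] H}

theorem neg_apply_apply (h : IsWeylSystem D A) (z : I → ℝ) (x : H) : A (-z) (A z x) = x := by
  rw [h.mul, neg_add_cancel, h.zero, cocycle, neg_dotProduct, skew_dotProduct_self h.skew]
  simp

theorem apply_neg_apply (h : IsWeylSystem D A) (z : I → ℝ) (x : H) : A z (A (-z) x) = x := by
  simpa using h.neg_apply_apply (-z) x

theorem inner_apply_apply (h : IsWeylSystem D A) (z w : I → ℝ) (x y : H) :
    ⟪A z x, A w y⟫_ℂ = cocycle D (-z) w * ⟪x, A (w - z) y⟫_ℂ := by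
  rw [← ContinuousLinearMap.adjoint_inner_right, h.adjoint, h.mul, inner_smul_right,
    neg_add_eq_sub]

end IsWeylSystem

/-- The Hermitian matrix `α + ½ i ω`. -/
def hermMatrix {J : Type} (α ω : Matrix J J ℝ) : Matrix J J ℂ :=
  Matrix.of fun i j => (α i j : ℂ) + (ω i j : ℂ) / 2 * Complex.I

/-- The sesquilinear form of `α + ½ i ω` on real vectors. -/
def hermForm (α ω : Matrix I I ℝ) : Matrix (I → ℝ) (I → ℝ) ℂ :=
  Matrix.of fun z w => ((z ⬝ᵥ α *ᵥ w : ℝ) : ℂ) + ((z ⬝ᵥ ω *ᵥ w : ℝ) : ℂ) / 2 * Complex.I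

theorem hermForm_eq_sum (α ω : Matrix I I ℝ) (z w : I → ℝ) :
    hermForm α ω z w = ∑ i, ∑ j, (z i : ℂ) * hermMatrix α ω i j * (w j : ℂ) := by
  simp only [hermForm, hermMatrix, Matrix.of_apply, dotProduct, Matrix.mulVec, Finset.mul_sum,
    Complex.ofReal_sum, Complex.ofReal_mul, Finset.sum_div, Finset.sum_mul]
  rw [← Finset.sum_add_distrib]
  refine Finset.sum_congr rfl fun i _ => ?_
  rw [← Finset.sum_add_distrib]
  refine Finset.sum_congr rfl fun j _ => ?_
  ring

/-- Real linear combinations of the Gram vectors of `α + ½ i ω` have the form of this matrix as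
their Gram kernel. -/
theorem posSemidef_hermForm {α ω : Matrix I I ℝ} (h : (hermMatrix α ω).PosSemidef) :
    (hermForm α ω).PosSemidef := by
  obtain ⟨G, _, _, _, u, hu⟩ := exists_gram_eq h
  convert posSemidef_gram (fun z : I → ℝ => ∑ i, (z i : ℂ) • u i) using 1
  ext z w
  rw [hermForm_eq_sum, Matrix.of_apply, sum_inner]
  refine Finset.sum_congr rfl fun i _ => ?_
  rw [inner_sum]
  refine Finset.sum_congr rfl fun j _ => ?_
  rw [inner_smul_left, inner_smul_right, hu, Complex.conj_ofReal]
  ring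

/-- If the kernel `exp(zᵀ (α + ½ i ω) w)` is positive semidefinite on real vectors, then so is the
matrix `α + ½ i ω`: subtracting the value `1` at the origin keeps the kernel positive, and its
part of second order at the origin is the form of the matrix. -/
theorem posSemidef_hermMatrix_of_cexp [DecidableEq I] {α ω : Matrix I I ℝ}
    (h : (Matrix.of fun z w => Complex.exp (hermForm α ω z w)).PosSemidef) :
    (hermMatrix α ω).PosSemidef := by
  obtain ⟨G, _, _, _, u, hu⟩ := exists_gram_eq h
  have h1 : ∀ s : ℝ, 0 ≤ s →
      (Matrix.of fun i j => Complex.exp (s * hermMatrix α ω i j) - 1).PosSemidef := by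
    intro s hs
    convert posSemidef_gram (fun i : I => u (Pi.single i (√s)) - u 0) using 1
    ext i j
    have h2 : hermForm α ω (Pi.single i (√s)) (Pi.single j (√s)) = s * hermMatrix α ω i j := by
      rw [hermForm_eq_sum, Finset.sum_eq_single i, Finset.sum_eq_single j]
      · simp only [Pi.single_eq_same]
        nth_rewrite 3 [← Real.mul_self_sqrt hs]
        push_cast
        ring
      · intro b _ hb
        simp [hb]
      · simp
      · intro b _ hb
        simp [hb]
      · simp
    simp only [Matrix.of_apply, inner_sub_left, inner_sub_right, hu, h2]
    simp [hermForm]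
  refine posSemidef_of_tendsto (F := fun n : ℕ => ((n : ℝ) + 1) •
    Matrix.of fun i j => Complex.exp ((((n : ℝ) + 1)⁻¹ : ℝ) * hermMatrix α ω i j) - 1)
    (fun n => (h1 _ (by positivity)).smul (by positivity)) fun i j => ?_
  have hd : HasDerivAt (fun s : ℝ => Complex.exp (s * hermMatrix α ω i j))
      (hermMatrix α ω i j) 0 := by
    have h3 : HasDerivAt (fun s : ℝ => (s : ℂ) * hermMatrix α ω i j) (1 * hermMatrix α ω i j) 0 :=
      (Complex.ofRealCLM.hasDerivAt (x := (0 : ℝ))).mul_const _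
    simpa using h3.cexp
  have h4 := hd.tendsto_slope_zero_right
  have h5 : Tendsto (fun n : ℕ => ((n : ℝ) + 1)⁻¹) atTop (𝓝[>] 0) := by
    refine tendsto_nhdsWithin_iff.2 ⟨?_, Eventually.of_forall fun n => ?_⟩
    · simpa using tendsto_one_div_add_atTop_nhds_zero_nat (𝕜 := ℝ)
    · exact inv_pos.2 (by positivity : (0 : ℝ) < n + 1)
  refine (h4.comp h5).congr fun n => ?_
  simp

end WeylSystems

/-! ### Gaussian functions -/

section Gaussian

open scoped ComplexOrder
open Filter Topology ProbabilityTheory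

variable {ι : Type} [Fintype ι]

/-- The Gaussian kernel `exp(½ i zᵀ ω w) g(w - z)` is the product of the rank-one kernel
`conj g(z) g(w)` and the exponential of the form of `α + ½ i ω`, so that its positivity is governed
by this matrix. -/
theorem cocycle_mul_gaussianFn {α ω : Matrix (ι ⊕ ι) (ι ⊕ ι) ℝ} (hα : α.IsSymm)
    (d z w : ι ⊕ ι → ℝ) :
    cocycle ω (-z) w * gaussianFn d α (w - z) =
      starRingEnd ℂ (gaussianFn d α z) * gaussianFn d α w * Complex.exp (hermForm α ω z w) := by
  have h1 : w ⬝ᵥ α *ᵥ z = z ⬝ᵥ α *ᵥ w := by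
    rw [Matrix.dotProduct_mulVec, dotProduct_comm, ← Matrix.mulVec_transpose, hα]
  have h2 : (w - z) ⬝ᵥ α *ᵥ (w - z) = w ⬝ᵥ α *ᵥ w + z ⬝ᵥ α *ᵥ z - 2 * (z ⬝ᵥ α *ᵥ w) := by
    rw [Matrix.mulVec_sub, dotProduct_sub, sub_dotProduct, sub_dotProduct, h1]
    ring
  have h3 : d ⬝ᵥ (w - z) = d ⬝ᵥ w - d ⬝ᵥ z := dotProduct_sub _ _ _
  simp only [cocycle, gaussianFn, hermForm, Matrix.of_apply, h2, h3, neg_dotProduct,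
    ← Complex.exp_conj, ← Complex.exp_add]
  congr 1
  simp only [map_add, map_neg, map_div₀, map_mul, Complex.conj_ofReal, Complex.conj_I, map_ofNat]
  push_cast
  ring

/-- The standard Gaussian average of `½ (1 + cos s) exp(i s x)`. -/
theorem integral_cos_gaussian (x : ℝ) :
    ∫ s, (((1 + Real.cos s) / 2 : ℝ) : ℂ) * Complex.exp ((s * x : ℝ) * Complex.I)
        ∂(gaussianReal 0 1) =
      Complex.exp (-((x ^ 2 : ℝ) : ℂ) / 2) *
        (((1 + Real.exp (-1 / 2) * Real.cosh x) / 2 : ℝ) : ℂ) := by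
  have hF : ∀ t : ℝ, ∫ s : ℝ, Complex.exp ((s * t : ℝ) * Complex.I) ∂(gaussianReal 0 1) =
      Complex.exp (-((t ^ 2 : ℝ) : ℂ) / 2) := by
    intro t
    have h := charFun_gaussianReal (μ := 0) (v := 1) t
    rw [charFun_apply_real] at h
    convert h using 2
    · ext s
      push_cast
      ring_nf
    · push_cast
      simp
      ring
  have hI : ∀ t : ℝ, Integrable (fun s : ℝ => Complex.exp ((s * t : ℝ) * Complex.I))
      (gaussianReal 0 1) := fun t =>
    Integrable.of_bound (C := 1) (by fun_prop) (ae_of_all _ fun s =>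
      (Complex.norm_exp_ofReal_mul_I _).le)
  have h1 : ∀ s : ℝ, (((1 + Real.cos s) / 2 : ℝ) : ℂ) * Complex.exp ((s * x : ℝ) * Complex.I) =
      1 / 2 * Complex.exp ((s * x : ℝ) * Complex.I) +
      (1 / 4 * Complex.exp ((s * (x + 1) : ℝ) * Complex.I) +
        1 / 4 * Complex.exp ((s * (x - 1) : ℝ) * Complex.I)) := by
    intro s
    have e1 : Complex.exp ((s * (x + 1) : ℝ) * Complex.I) =
        Complex.exp ((s * x : ℝ) * Complex.I) * Complex.exp (s * Complex.I) := by
      rw [← Complex.exp_add]; congr 1; push_cast; ring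
    have e2 : Complex.exp ((s * (x - 1) : ℝ) * Complex.I) =
        Complex.exp ((s * x : ℝ) * Complex.I) * Complex.exp (-s * Complex.I) := by
      rw [← Complex.exp_add]; congr 1; push_cast; ring
    rw [e1, e2]
    push_cast [Complex.cos]
    ring
  have hadd : Integrable (fun s : ℝ => 1 / 4 * Complex.exp ((s * (x + 1) : ℝ) * Complex.I) +
      1 / 4 * Complex.exp ((s * (x - 1) : ℝ) * Complex.I)) (gaussianReal 0 1) :=
    ((hI _).const_mul _).add ((hI _).const_mul _)
  simp only [h1]
  rw [integral_add ((hI _).const_mul _) hadd,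
    integral_add ((hI _).const_mul _) ((hI _).const_mul _), integral_const_mul, integral_const_mul,
    integral_const_mul, hF, hF, hF]
  have e1 : Complex.exp (-(((x + 1) ^ 2 : ℝ) : ℂ) / 2) = Complex.exp (-((x ^ 2 : ℝ) : ℂ) / 2) *
      (Complex.exp (-1 / 2) * Complex.exp (-x)) := by
    rw [← Complex.exp_add, ← Complex.exp_add]; congr 1; push_cast; ring
  have e2 : Complex.exp (-(((x - 1) ^ 2 : ℝ) : ℂ) / 2) = Complex.exp (-((x ^ 2 : ℝ) : ℂ) / 2) *
      (Complex.exp (-1 / 2) * Complex.exp x) := by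
    rw [← Complex.exp_add, ← Complex.exp_add]; congr 1; push_cast; ring
  rw [e1, e2]
  push_cast [Complex.cosh]
  ring

/-- Subtracting the rank-one form `λ λᵀ` from the covariance multiplies the Gaussian function by
`exp(½ (λ·z)²)`. -/
theorem gaussianFn_sub_vecMulVec (d lam z : ι ⊕ ι → ℝ) (α : Matrix (ι ⊕ ι) (ι ⊕ ι) ℝ) :
    gaussianFn d (α - Matrix.vecMulVec lam lam) z * Complex.exp (-(((lam ⬝ᵥ z) ^ 2 : ℝ) : ℂ) / 2) =
      gaussianFn d α z := by
  simp only [gaussianFn, ← Complex.exp_add]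
  congr 1
  rw [Matrix.sub_mulVec, dotProduct_sub, Matrix.vecMulVec_mulVec, dotProduct_smul,
    dotProduct_comm z lam]
  push_cast
  simp
  ring

end Gaussian

/-! ### Gaussian intertwiners between Weyl systems -/

section Intertwiners

open scoped ComplexOrder
open Filter Topology ProbabilityTheory

variable {ι : Type} [Fintype ι] {H₀ : Type} {H : Type*}
  [NormedAddCommGroup H₀] [InnerProductSpace ℂ H₀] [CompleteSpace H₀]
  [NormedAddCommGroup H] [InnerProductSpace ℂ H] [CompleteSpace H]
  {D D' α : Matrix (ι ⊕ ι) (ι ⊕ ι) ℝ} {d : ι ⊕ ι → ℝ}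
  {A : (ι ⊕ ι → ℝ) → H →L[ℂ] H} {U : (ι ⊕ ι → ℝ) → H₀ →L[ℂ] H₀} {V : H₀ →L[ℂ] H}

theorem cocycle_sub (D D' : Matrix (ι ⊕ ι) (ι ⊕ ι) ℝ) (z w : ι ⊕ ι → ℝ) :
    cocycle D (-z) w = cocycle (D - D') (-z) w * cocycle D' (-z) w := by
  simp only [cocycle, ← Complex.exp_add]
  congr 1
  rw [Matrix.sub_mulVec, dotProduct_sub]
  push_cast
  ring

/-- The Gram kernel of the vectors `A(z) V f`. -/
theorem inner_intertwiner (hA : IsWeylSystem D A) (hU : IsWeylSystem D' U)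
    (hV : ∀ z f f', ⟪V f, A z (V f')⟫_ℂ = gaussianFn d α z * ⟪f, U z f'⟫_ℂ)
    (z w : ι ⊕ ι → ℝ) (f f' : H₀) :
    ⟪A z (V f), A w (V f')⟫_ℂ =
      cocycle (D - D') (-z) w * gaussianFn d α (w - z) * ⟪U z f, U w f'⟫_ℂ := by
  rw [hA.inner_apply_apply, hU.inner_apply_apply, hV, cocycle_sub D D']
  ring

/-- Complete positivity: a Gaussian intertwiner between Weyl systems with forms `D'` and `D`
exists only if `α + ½ i (D - D') ≥ 0`. -/
theorem posSemidef_of_intertwiner [DecidableEq ι] [Nontrivial H₀] (hα : α.IsSymm)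
    (hA : IsWeylSystem D A) (hU : IsWeylSystem D' U)
    (hV : ∀ z f f', ⟪V f, A z (V f')⟫_ℂ = gaussianFn d α z * ⟪f, U z f'⟫_ℂ) :
    (hermMatrix α (D - D')).PosSemidef := by
  obtain ⟨f, hf⟩ := exists_norm_eq H₀ zero_le_one
  refine posSemidef_hermMatrix_of_cexp ?_
  -- the vectors `A(z) V U(-z) f` have a Gaussian Gram kernel for the form `D - D'`; dividing by its
  -- rank-one factor leaves the exponential of `hermForm α (D - D')`
  have h1 := (posSemidef_conj_mul (fun z => (gaussianFn d α z)⁻¹)).hadamard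
    (posSemidef_gram (fun z => A z (V (U (-z) f))))
  refine posSemidef_congr h1 fun z w => ?_
  rw [Matrix.hadamard_apply, Matrix.of_apply, Matrix.of_apply, Matrix.of_apply,
    inner_intertwiner hA hU hV, hU.apply_neg_apply, hU.apply_neg_apply, cocycle_mul_gaussianFn hα,
    inner_self_eq_norm_sq_to_K, hf]
  have h2 : gaussianFn d α z ≠ 0 := Complex.exp_ne_zero _
  have h3 : gaussianFn d α w ≠ 0 := Complex.exp_ne_zero _
  have h4 : starRingEnd ℂ (gaussianFn d α z) ≠ 0 := by simpa using h2
  rw [map_inv₀]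
  field_simp
  simp

/-- Two self-adjoint operators which agree as forms on a family of vectors and vanish on its
orthogonal complement are equal. -/
theorem eq_of_inner_eq {X : Type*} {v : X → H} {T₁ T₂ : H →L[ℂ] H} (h₁ : IsSelfAdjoint T₁)
    (h₂ : IsSelfAdjoint T₂) (h : ∀ x y, ⟪v x, T₁ (v y)⟫_ℂ = ⟪v x, T₂ (v y)⟫_ℂ)
    (k₁ : ∀ w, (∀ x, ⟪v x, w⟫_ℂ = 0) → T₁ w = 0) (k₂ : ∀ w, (∀ x, ⟪v x, w⟫_ℂ = 0) → T₂ w = 0) :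
    T₁ = T₂ := by
  have hs : ∀ x y, ⟪(T₁ - T₂) x, y⟫_ℂ = ⟪x, (T₁ - T₂) y⟫_ℂ := (h₁.sub h₂).isSymmetric
  have hk : ∀ w, (∀ x, ⟪v x, (T₁ - T₂) w⟫_ℂ = 0) → (T₁ - T₂) w = 0 := by
    intro w hw
    have h3 : (T₁ - T₂) ((T₁ - T₂) w) = 0 := by
      rw [sub_apply, k₁ _ hw, k₂ _ hw, sub_zero]
    rw [← inner_self_eq_zero (𝕜 := ℂ), hs, h3, inner_zero_right]
  have hv : ∀ y, (T₁ - T₂) (v y) = 0 := fun y => hk _ fun x => by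
    rw [sub_apply, inner_sub_right, h, sub_self]
  rw [← sub_eq_zero]
  ext w
  exact hk w fun x => by rw [← hs, hv, inner_zero_left]

/-- If the noise `α` of a Gaussian intertwiner is not minimal, in that the rank-one form `λ λᵀ`
can be subtracted from it, then the intertwiner is not extreme: `V† A(z) V = g(z) U(z)` is
decomposed by a nontrivial operator `0 ≤ T ≤ 1` in the commutant of the Weyl operators `A(z)`. The
operator comes from writing `g(z)` as a Gaussian average over `s` of the functions
`exp(½ (λ·z)²) g(z) exp(i s λ·z)` and weighting this average with the density `½ (1 + cos s)`. -/
theorem exists_commutant_of_intertwiner (hα : α.IsSymm)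
    (hA : IsWeylSystem D A) (hU : IsWeylSystem D' U)
    (hV : ∀ z f f', ⟪V f, A z (V f')⟫_ℂ = gaussianFn d α z * ⟪f, U z f'⟫_ℂ)
    (lam : ι ⊕ ι → ℝ) (hlam : (hermMatrix (α - Matrix.vecMulVec lam lam) (D - D')).PosSemidef) :
    ∃ T : H →L[ℂ] H, 0 ≤ T ∧ T ≤ 1 ∧ (∀ z x, T (A z x) = A z (T x)) ∧
      ∀ z f f', ⟪V f, T (A z (V f'))⟫_ℂ =
        (((1 + Real.exp (-1 / 2) * Real.cosh (lam ⬝ᵥ z)) / 2 : ℝ) : ℂ) * gaussianFn d α z *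
          ⟪f, U z f'⟫_ℂ := by
  have hα' : (α - Matrix.vecMulVec lam lam).IsSymm := by
    refine hα.sub ?_
    ext i j
    simp [Matrix.vecMulVec, mul_comm]
  let v : (ι ⊕ ι → ℝ) × H₀ → H := fun x => A x.1 (V x.2)
  -- the kernel which is weighted by a density `h` against the Gaussian measure
  let k : (ℝ → ℝ) → Matrix ((ι ⊕ ι → ℝ) × H₀) ((ι ⊕ ι → ℝ) × H₀) ℂ := fun h => Matrix.of fun x y =>
    cocycle (D - D') (-x.1) y.1 * gaussianFn d (α - Matrix.vecMulVec lam lam) (y.1 - x.1) *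
      (∫ s, (h s : ℂ) * Complex.exp ((s * (lam ⬝ᵥ y.1 - lam ⬝ᵥ x.1) : ℝ) * Complex.I)
        ∂(gaussianReal 0 1)) * ⟪U x.1 x.2, U y.1 y.2⟫_ℂ
  have hk : ∀ h : ℝ → ℝ, Continuous h → (∀ s, 0 ≤ h s) → (∀ s, h s ≤ 1) → (k h).PosSemidef := by
    intro h hc h0 h1
    have p1 := posSemidef_conj_mul (fun x : (ι ⊕ ι → ℝ) × H₀ =>
      gaussianFn d (α - Matrix.vecMulVec lam lam) x.1)
    have p2 := (posSemidef_cexp (posSemidef_hermForm hlam)).submatrix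
      (fun x : (ι ⊕ ι → ℝ) × H₀ => x.1)
    have p3 := (posSemidef_fourier (gaussianReal 0 1) h hc h0 h1).submatrix
      (fun x : (ι ⊕ ι → ℝ) × H₀ => lam ⬝ᵥ x.1)
    have p4 := posSemidef_gram (fun x : (ι ⊕ ι → ℝ) × H₀ => U x.1 x.2)
    refine posSemidef_congr (((p1.hadamard p2).hadamard p3).hadamard p4) fun x y => ?_
    simp only [k, Matrix.hadamard_apply, Matrix.of_apply, Matrix.submatrix_apply,
      cocycle_mul_gaussianFn hα']
  have hc : ∀ s : ℝ, 0 ≤ (1 + Real.cos s) / 2 ∧ (1 + Real.cos s) / 2 ≤ 1 := fun s =>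
    ⟨by linarith [Real.neg_one_le_cos s], by linarith [Real.cos_le_one s]⟩
  have hcc : Continuous fun s : ℝ => (1 + Real.cos s) / 2 := by fun_prop
  -- the total weight `1` gives back the Gram kernel of the vectors `A(z) V f`
  have hadd : k (fun s => (1 + Real.cos s) / 2) + k (fun s => 1 - (1 + Real.cos s) / 2) =
      Matrix.of fun x y => ⟪v x, v y⟫_ℂ := by
    ext x y
    have hI : ∀ h : ℝ → ℝ, Continuous h → (∀ s, 0 ≤ h s ∧ h s ≤ 1) →
        Integrable (fun s => (h s : ℂ) * Complex.exp ((s * (lam ⬝ᵥ y.1 - lam ⬝ᵥ x.1) : ℝ) *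
          Complex.I)) (gaussianReal 0 1) := by
      intro h hc h01
      refine Integrable.of_bound (C := 1) (by fun_prop) (ae_of_all _ fun s => ?_)
      rw [norm_mul, Complex.norm_exp_ofReal_mul_I, mul_one, Complex.norm_real, Real.norm_eq_abs,
        abs_of_nonneg (h01 s).1]
      exact (h01 s).2
    have h1 := charFun_gaussianReal (μ := 0) (v := 1) (lam ⬝ᵥ y.1 - lam ⬝ᵥ x.1)
    rw [charFun_apply_real] at h1
    simp only [Matrix.add_apply, k, Matrix.of_apply, v, inner_intertwiner hA hU hV]
    rw [← add_mul, ← mul_add, ← integral_add (hI _ hcc hc)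
      (hI (fun s => 1 - (1 + Real.cos s) / 2) (by fun_prop) fun s =>
        ⟨by linarith [(hc s).2], by linarith [(hc s).1]⟩)]
    simp only [← add_mul, ← Complex.ofReal_add, add_sub_cancel, Complex.ofReal_one, one_mul]
    rw [← gaussianFn_sub_vecMulVec d lam (y.1 - x.1) α, dotProduct_sub, ← mul_assoc]
    congr 2
    convert h1 using 2
    · ext s
      push_cast
      ring_nf
    · push_cast
      simp
      ring
  obtain ⟨T, hT0, hT1, hTv, hTk⟩ := exists_radonNikodym v (hk _ hcc (fun s => (hc s).1)
    (fun s => (hc s).2)) (by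
      rw [← hadd, add_sub_cancel_left]
      exact hk _ (by fun_prop) (fun s => by linarith [(hc s).2]) (fun s => by linarith [(hc s).1]))
  have hTsa : IsSelfAdjoint T := IsSelfAdjoint.of_nonneg hT0
  -- the explicit form of the dominated kernel
  have hkey : ∀ x y, ⟪v x, T (v y)⟫_ℂ = cocycle D (-x.1) y.1 *
      ((((1 + Real.exp (-1 / 2) * Real.cosh (lam ⬝ᵥ (y.1 - x.1))) / 2 : ℝ) : ℂ) *
        gaussianFn d α (y.1 - x.1)) * ⟪x.2, U (y.1 - x.1) y.2⟫_ℂ := by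
    intro x y
    rw [hTv, ← gaussianFn_sub_vecMulVec d lam (y.1 - x.1) α, cocycle_sub D D']
    simp only [k, Matrix.of_apply, integral_cos_gaussian, hU.inner_apply_apply, dotProduct_sub]
    ring
  have hAv : ∀ u x, A u (v x) = cocycle D u x.1 • v (u + x.1, x.2) := fun u x => hA.mul _ _ _
  refine ⟨T, hT0, hT1, fun u x => ?_, fun z f f' => ?_⟩
  · -- the kernel of `T` is covariant under the translations `v (z, f) ↦ A u (v (z, f))`, which are
    -- `v (u + z, f)` up to a phase
    have heq : A (-u) ∘L T ∘L A u = T := by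
      refine eq_of_inner_eq (v := v) ?_ hTsa ?_ ?_ hTk
      · have := hTsa.conj_adjoint (A (-u))
        rwa [hA.adjoint, neg_neg] at this
      · intro x y
        rw [ContinuousLinearMap.comp_apply, ContinuousLinearMap.comp_apply, ← hA.adjoint,
          ContinuousLinearMap.adjoint_inner_right, hAv, hAv, map_smul, inner_smul_left,
          inner_smul_right, hkey, hkey]
        simp only [add_sub_add_left_eq_sub, ← mul_assoc]
        congr 3
        simp only [cocycle, ← Complex.exp_conj, ← Complex.exp_add]
        congr 1
        simp only [map_neg, map_mul, map_div₀, Complex.conj_ofReal, Complex.conj_I, map_ofNat,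
          neg_dotProduct, add_dotProduct, Matrix.mulVec_add, dotProduct_add, neg_add,
          skew_dotProduct_self hA.skew, skew_dotProduct hA.skew u x.1]
        push_cast
        ring
      · intro w hw
        have h1 : T (A u w) = 0 := hTk _ fun x => by
          rw [← neg_neg u, ← hA.adjoint, ContinuousLinearMap.adjoint_inner_right, hAv,
            inner_smul_left, hw, mul_zero]
        simp [h1]
    have h2 := congrArg (fun S : H →L[ℂ] H => A u (S x)) heq
    simp only [ContinuousLinearMap.comp_apply, hA.apply_neg_apply] at h2
    exact h2
  · have h1 := hkey (0, f) (z, f')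
    simp only [v, hA.zero, sub_zero, neg_zero] at h1
    rw [one_apply_eq_self] at h1
    rw [h1]
    simp [cocycle]

end Intertwiners

/-! ### Rank of the noise matrix -/

section Rank

open scoped ComplexOrder

variable {I : Type} [Fintype I]

theorem conj_mulVec {M : Matrix I I ℂ} (hM : M.IsHermitian) (v : I → ℂ) :
    star (M *ᵥ v) = Mᵀ *ᵥ star v := by
  rw [Matrix.star_mulVec, hM, ← Matrix.mulVec_transpose]

/-- The range of a Hermitian matrix of rank more than half its size contains a nonzero real
vector, because it meets its complex conjugate. -/
theorem exists_real_mem_range {M : Matrix I I ℂ} (hM : M.IsHermitian)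
    (hr : Fintype.card I < 2 * M.rank) :
    ∃ (lam : I → ℝ) (v : I → ℂ), lam ≠ 0 ∧ M *ᵥ v = fun i => (lam i : ℂ) := by
  have h1 : ∃ x ∈ LinearMap.range M.mulVecLin ⊓ LinearMap.range Mᵀ.mulVecLin, x ≠ 0 := by
    apply Submodule.exists_mem_ne_zero_of_ne_bot
    intro hbot
    have h2 := Submodule.finrank_sup_add_finrank_inf_eq (LinearMap.range M.mulVecLin)
      (LinearMap.range Mᵀ.mulVecLin)
    have h3 : Module.finrank ℂ (LinearMap.range M.mulVecLin) = M.rank := rfl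
    have h4 : Module.finrank ℂ (LinearMap.range Mᵀ.mulVecLin) = M.rank := M.rank_transpose
    have h5 := Submodule.finrank_le
      (LinearMap.range M.mulVecLin ⊔ LinearMap.range Mᵀ.mulVecLin)
    rw [Module.finrank_fintype_fun_eq_card] at h5
    rw [hbot, h3, h4, finrank_bot] at h2
    omega
  obtain ⟨x, ⟨⟨v, hv⟩, ⟨u, hu⟩⟩, hx⟩ := h1
  rw [Matrix.mulVecLin_apply] at hv hu
  have hu' : M *ᵥ star u = star x := by
    rw [← hu, ← star_star (M *ᵥ star u), conj_mulVec hM, star_star]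
  by_cases hre : (fun i => (x i).re) = (0 : I → ℝ)
  · refine ⟨fun i => (x i).im, (-Complex.I / 2) • (v - star u), fun him => hx ?_, ?_⟩
    · ext i
      exact Complex.ext (congrFun hre i) (congrFun him i)
    · rw [Matrix.mulVec_smul, Matrix.mulVec_sub, hv, hu']
      ext i
      apply Complex.ext <;> simp
      ring
  · refine ⟨fun i => (x i).re, (1 / 2 : ℂ) • (v + star u), hre, ?_⟩
    rw [Matrix.mulVec_smul, Matrix.mulVec_add, hv, hu']
    ext i
    apply Complex.ext <;> simp
    ring

/-- If `α + ½ i ω ≥ 0` has rank more than half its size, then a real rank-one form can be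
subtracted from `α`. -/
theorem exists_sub_vecMulVec_posSemidef {α ω : Matrix I I ℝ}
    (h : (hermMatrix α ω).PosSemidef) (hr : Fintype.card I < 2 * (hermMatrix α ω).rank) :
    ∃ lam : I → ℝ, lam ≠ 0 ∧ (hermMatrix (α - Matrix.vecMulVec lam lam) ω).PosSemidef := by
  obtain ⟨lam, v, hlam, hv⟩ := exists_real_mem_range h.1 hr
  obtain ⟨G, _, _, _, u, hu⟩ := exists_gram_eq h
  have hp : ∀ i, ⟪u i, ∑ j, v j • u j⟫_ℂ = lam i := by
    intro i
    rw [← congrFun hv i, inner_sum, Matrix.mulVec, dotProduct]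
    refine Finset.sum_congr rfl fun j _ => ?_
    rw [inner_smul_right, hu, mul_comm]
  generalize (∑ j, v j • u j) = p at hp
  -- projecting the Gram vectors `u i` onto the complement of `p`, where `⟨u i, p⟩ = λ i`, subtracts
  -- the matrix `λ λᵀ / ‖p‖²` from their Gram matrix
  have hp0 : ‖p‖ ≠ 0 := by
    intro h0
    rw [norm_eq_zero] at h0
    refine hlam (funext fun i => ?_)
    have := hp i
    rw [h0, inner_zero_right] at this
    exact_mod_cast this.symm
  have hp' : ∀ i, ⟪p, u i⟫_ℂ = lam i := fun i => by
    rw [← inner_conj_symm, hp, Complex.conj_ofReal]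
  refine ⟨(‖p‖⁻¹) • lam, smul_ne_zero (inv_ne_zero hp0) hlam, ?_⟩
  refine posSemidef_congr (posSemidef_gram fun i => u i - ((lam i : ℂ) / (‖p‖ : ℂ) ^ 2) • p)
    fun i j => ?_
  have hpc : (‖p‖ : ℂ) ≠ 0 := by exact_mod_cast hp0
  simp only [Matrix.of_apply, inner_sub_left, inner_sub_right, inner_smul_left, inner_smul_right,
    hu, hp, hp', inner_self_eq_norm_sq_to_K, map_div₀, map_pow, Complex.conj_ofReal]
  simp only [hermMatrix, Matrix.of_apply, Matrix.sub_apply, Matrix.vecMulVec, Pi.smul_apply,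
    smul_eq_mul]
  push_cast
  simp only [Complex.coe_algebraMap]
  field_simp
  ring

end Rank

/-! ### Symplectic eigenvalues of covariance matrices -/

section SymplecticEigenvalues

open scoped ComplexOrder

theorem sympForm_transpose {κ : Type} [DecidableEq κ] : (sympForm κ)ᵀ = -sympForm κ := by
  simp [sympForm, Matrix.fromBlocks_transpose, Matrix.fromBlocks_neg]

variable {κ : Type} [Fintype κ] [DecidableEq κ]

theorem sympForm_mul_self : sympForm κ * sympForm κ = -1 := by
  simp [sympForm, Matrix.fromBlocks_multiply, ← Matrix.fromBlocks_one, Matrix.fromBlocks_neg]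

theorem sympForm_inv : (sympForm κ)⁻¹ = -sympForm κ :=
  Matrix.inv_eq_right_inv (by rw [mul_neg, sympForm_mul_self, neg_neg])

theorem hermMatrix_eq {I : Type} (α ω : Matrix I I ℝ) :
    hermMatrix α ω = α.map ((↑) : ℝ → ℂ) + (Complex.I / 2) • ω.map ((↑) : ℝ → ℂ) := by
  ext i j
  simp [hermMatrix]
  ring

theorem sympForm_map_mul_self :
    (sympForm κ).map ((↑) : ℝ → ℂ) * (sympForm κ).map ((↑) : ℝ → ℂ) = -1 := by
  have := congrArg (fun M : Matrix (κ ⊕ κ) (κ ⊕ κ) ℝ => M.map Complex.ofRealHom)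
    (sympForm_mul_self (κ := κ))
  simp only [Matrix.map_mul] at this
  refine this.trans ?_
  ext i j
  simp [Matrix.one_apply, apply_ite]

theorem map_mul_sympForm_inv (σ : Matrix (κ ⊕ κ) (κ ⊕ κ) ℝ) :
    (σ * (sympForm κ)⁻¹).map ((↑) : ℝ → ℂ) =
      -(σ.map ((↑) : ℝ → ℂ) * (sympForm κ).map ((↑) : ℝ → ℂ)) := by
  rw [sympForm_inv, mul_neg]
  ext i j
  simp [Matrix.mul_apply]

theorem hermMatrix_transpose {κ : Type} [DecidableEq κ] {σ : Matrix (κ ⊕ κ) (κ ⊕ κ) ℝ}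
    (hσ : σ.IsSymm) :
    (hermMatrix σ (sympForm κ))ᵀ =
      σ.map ((↑) : ℝ → ℂ) - (Complex.I / 2) • (sympForm κ).map ((↑) : ℝ → ℂ) := by
  ext i j
  have := congrFun (congrFun (sympForm_transpose (κ := κ)) i) j
  simp only [Matrix.transpose_apply, Matrix.neg_apply] at this
  simp [hermMatrix, hσ.apply i j, this]
  ring

theorem star_star_dotProduct_mulVec {I : Type} [Fintype I] (M : Matrix I I ℂ) (w : I → ℂ) :
    star (star w ⬝ᵥ M *ᵥ w) = star w ⬝ᵥ Mᴴ *ᵥ w := by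
  refine (Matrix.star_dotProduct (M *ᵥ w) w).symm.trans ?_
  rw [Matrix.star_mulVec, ← Matrix.dotProduct_mulVec]

/-- For `σ + ½ i Δ ≥ 0` the eigenvalues of `σ Δ⁻¹` are nonzero and purely imaginary. -/
theorem re_eq_zero_of_isRoot {σ : Matrix (κ ⊕ κ) (κ ⊕ κ) ℝ} (hσ : σ.IsSymm)
    (h : (hermMatrix σ (sympForm κ)).PosSemidef) {c : ℂ}
    (hc : ((σ * (sympForm κ)⁻¹).map ((↑) : ℝ → ℂ)).charpoly.IsRoot c) : c.re = 0 ∧ c.im ≠ 0 := by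
  set E : Matrix (κ ⊕ κ) (κ ⊕ κ) ℂ := (sympForm κ).map ((↑) : ℝ → ℂ) with hE
  set s : Matrix (κ ⊕ κ) (κ ⊕ κ) ℂ := σ.map ((↑) : ℝ → ℂ) with hs
  have hEE : E * E = -1 := sympForm_map_mul_self
  have hC : (σ * (sympForm κ)⁻¹).map ((↑) : ℝ → ℂ) = -(s * E) := map_mul_sympForm_inv σ
  have hEt : Eᴴ = -E := by
    ext i j
    have := congrFun (congrFun (sympForm_transpose (κ := κ)) i) j
    simp only [Matrix.transpose_apply, Matrix.neg_apply] at this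
    simp [hE, this]
  have hst : sᴴ = s := by
    ext i j
    simp [hs, hσ.apply i j]
  have h1 : hermMatrix σ (sympForm κ) = s + (Complex.I / 2) • E := hermMatrix_eq _ _
  have h2 : (hermMatrix σ (sympForm κ))ᵀ = s - (Complex.I / 2) • E := hermMatrix_transpose hσ
  have hp1 := h
  have hp2 := h.transpose
  rw [h1] at hp1
  rw [h2] at hp2
  rw [Polynomial.IsRoot, Matrix.eval_charpoly] at hc
  obtain ⟨v, hv0, hv⟩ := Matrix.exists_mulVec_eq_zero_iff.2 hc
  rw [hC, sub_neg_eq_add, Matrix.add_mulVec, ← Matrix.mulVec_mulVec] at hv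
  set w := E *ᵥ v with hw
  have hEw : E *ᵥ w = -v := by
    rw [hw, Matrix.mulVec_mulVec, hEE, Matrix.neg_mulVec, Matrix.one_mulVec]
  have hw0 : w ≠ 0 := by
    intro h0
    rw [h0, Matrix.mulVec_zero] at hEw
    exact hv0 (neg_eq_zero.1 hEw.symm)
  have hsw : s *ᵥ w = c • (E *ᵥ w) := by
    have h3 : (Matrix.scalar (κ ⊕ κ) c) *ᵥ v = c • v := by
      rw [Matrix.scalar_apply]
      ext i
      simp [Matrix.mulVec_diagonal]
    rw [h3] at hv
    rw [hEw, smul_neg]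
    exact eq_neg_of_add_eq_zero_right hv
  -- the positive number `w† σ w` and the imaginary number `w† Δ w`
  obtain ⟨a, ha⟩ : ∃ a : ℝ, star w ⬝ᵥ s *ᵥ w = a := by
    refine ⟨(star w ⬝ᵥ s *ᵥ w).re, Complex.ext (by simp) ?_⟩
    have h5 : star (star w ⬝ᵥ s *ᵥ w) = star w ⬝ᵥ s *ᵥ w := by
      rw [star_star_dotProduct_mulVec, hst]
    have := congrArg Complex.im h5
    simp at this
    simp
    linarith
  obtain ⟨b, hb⟩ : ∃ b : ℝ, star w ⬝ᵥ E *ᵥ w = b * Complex.I := by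
    refine ⟨(star w ⬝ᵥ E *ᵥ w).im, Complex.ext ?_ (by simp)⟩
    have h5 : star (star w ⬝ᵥ E *ᵥ w) = -(star w ⬝ᵥ E *ᵥ w) := by
      rw [star_star_dotProduct_mulVec, hEt, Matrix.neg_mulVec, dotProduct_neg]
    have := congrArg Complex.re h5
    simp at this
    simp
    linarith
  have hab : (a : ℂ) = c * (b * Complex.I) := by
    rw [← ha, ← hb, hsw, dotProduct_smul, smul_eq_mul]
  have ha0 : a ≠ 0 := by
    intro h0
    have e1 : star w ⬝ᵥ (s + (Complex.I / 2) • E) *ᵥ w = ((-b / 2 : ℝ) : ℂ) := by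
      rw [Matrix.add_mulVec, Matrix.smul_mulVec, dotProduct_add, dotProduct_smul, ha, hb, h0,
        smul_eq_mul]
      push_cast
      linear_combination (b / 2 : ℂ) * Complex.I_mul_I
    have e2 : star w ⬝ᵥ (s - (Complex.I / 2) • E) *ᵥ w = ((b / 2 : ℝ) : ℂ) := by
      rw [Matrix.sub_mulVec, Matrix.smul_mulVec, dotProduct_sub, dotProduct_smul, ha, hb, h0,
        smul_eq_mul]
      push_cast
      linear_combination (-b / 2 : ℂ) * Complex.I_mul_I
    have n1 := hp1.dotProduct_mulVec_nonneg w
    have n2 := hp2.dotProduct_mulVec_nonneg w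
    rw [e1, Complex.zero_le_real] at n1
    rw [e2, Complex.zero_le_real] at n2
    have hb0 : b = 0 := by linarith
    have z1 := (hp1.dotProduct_mulVec_zero_iff w).1 (by rw [e1, hb0]; simp)
    have z2 := (hp2.dotProduct_mulVec_zero_iff w).1 (by rw [e2, hb0]; simp)
    rw [Matrix.add_mulVec, Matrix.smul_mulVec] at z1
    rw [Matrix.sub_mulVec, Matrix.smul_mulVec] at z2
    have z3 : Complex.I • (E *ᵥ w) = 0 := by
      have := congrArg₂ (· - ·) z1 z2
      simp only [sub_zero] at this
      rw [← this]
      module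
    rw [smul_eq_zero_iff_right Complex.I_ne_zero, hEw, neg_eq_zero] at z3
    exact hv0 z3
  have r1 := congrArg Complex.re hab
  have r2 := congrArg Complex.im hab
  simp at r1 r2
  have hb0 : b ≠ 0 := by
    rintro rfl
    simp at r1
    exact ha0 r1
  constructor
  · rcases r2 with h6 | h6
    · exact h6
    · exact absurd h6 hb0
  · intro him
    rw [him] at r1
    simp at r1
    exact ha0 r1

/-- A covariance matrix of `card κ` modes has `card κ` symplectic eigenvalues, and the value
`1/2` occurs among them at least `dim ker (σ + ½ i Δ)` times. -/
theorem symplecticEigenvalues_spec {σ : Matrix (κ ⊕ κ) (κ ⊕ κ) ℝ} (hσ : σ.IsSymm)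
    (h : (hermMatrix σ (sympForm κ)).PosSemidef) :
    (symplecticEigenvalues σ).card = Fintype.card κ ∧
      2 * Fintype.card κ ≤
        (symplecticEigenvalues σ).count (1 / 2) + (hermMatrix σ (sympForm κ)).rank := by
  set C := (σ * (sympForm κ)⁻¹).map ((↑) : ℝ → ℂ) with hC
  have hsym : symplecticEigenvalues σ =
      (C.charpoly.roots.filter fun c => 0 < c.im).map (fun c => ‖c‖) := rfl
  have hroot : ∀ c ∈ C.charpoly.roots, c.re = 0 ∧ c.im ≠ 0 := fun c hc =>
    re_eq_zero_of_isRoot hσ h (Polynomial.isRoot_of_mem_roots hc)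
  have hcard : C.charpoly.roots.card = 2 * Fintype.card κ := by
    rw [← (IsAlgClosed.splits C.charpoly).natDegree_eq_card_roots, Matrix.charpoly_natDegree_eq_dim,
      Fintype.card_sum, two_mul]
  have hconj : C.charpoly.roots.map (starRingEnd ℂ) = C.charpoly.roots := by
    rw [← (IsAlgClosed.splits C.charpoly).roots_map, ← Matrix.charpoly_map]
    congr 2
    ext i j
    simp [hC]
  -- the roots of the real polynomial are not real and come in conjugate pairs
  have hneg : (C.charpoly.roots.filter fun c => c.im < 0).card =
      (C.charpoly.roots.filter fun c => 0 < c.im).card := by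
    conv_rhs => rw [← hconj]
    rw [Multiset.filter_map, Multiset.card_map]
    congr 2
    ext c
    simp
  have hsplit : (C.charpoly.roots.filter fun c => 0 < c.im).card +
      (C.charpoly.roots.filter fun c => c.im < 0).card = 2 * Fintype.card κ := by
    rw [← hcard, ← Multiset.card_add]
    conv_rhs => rw [← Multiset.filter_add_not (fun c => 0 < c.im) C.charpoly.roots]
    congr 2
    refine Multiset.filter_congr fun c hc => ?_
    have := (hroot c hc).2
    rw [not_lt]
    exact ⟨le_of_lt, fun h5 => lt_of_le_of_ne h5 this⟩
  refine ⟨?_, ?_⟩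
  · rw [hsym, Multiset.card_map]
    omega
  · -- the eigenspace of `σ Δ⁻¹` for `i/2` is the kernel of `(σ + ½ i Δ)ᵀ Δ`, and its dimension is
    -- at most the multiplicity of the root `i/2`
    have h1 : C.charpoly.rootMultiplicity (Complex.I / 2) ≤
        (symplecticEigenvalues σ).count (1 / 2) := by
      have e1 : ‖Complex.I / 2‖ = (1 / 2 : ℝ) := by simp
      rw [← Polynomial.count_roots, hsym, Multiset.count_map, Multiset.count_eq_card_filter_eq,
        Multiset.filter_filter, ← e1]
      refine Multiset.card_le_card (Multiset.monotone_filter_right _ ?_)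
      rintro c rfl
      simp
    have h2 := LinearMap.finrank_eigenspace_le (Matrix.toLin' C) (Complex.I / 2)
    rw [Matrix.charpoly_toLin'] at h2
    have h3 : (C - (Complex.I / 2) • (1 : Matrix (κ ⊕ κ) (κ ⊕ κ) ℂ)).rank ≤
        (hermMatrix σ (sympForm κ)).rank := by
      rw [← Matrix.rank_transpose (hermMatrix σ (sympForm κ))]
      have : C - (Complex.I / 2) • (1 : Matrix (κ ⊕ κ) (κ ⊕ κ) ℂ) =
          (hermMatrix σ (sympForm κ))ᵀ * (-(sympForm κ).map ((↑) : ℝ → ℂ)) := by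
        rw [hermMatrix_transpose hσ, hC, map_mul_sympForm_inv, sub_mul, smul_mul_assoc, mul_neg,
          mul_neg, sympForm_map_mul_self, neg_neg]
      rw [this]
      exact Matrix.rank_mul_le_left _ _
    have h4 := LinearMap.finrank_range_add_finrank_ker
      (C - (Complex.I / 2) • (1 : Matrix (κ ⊕ κ) (κ ⊕ κ) ℂ)).mulVecLin
    rw [Module.finrank_fintype_fun_eq_card, Fintype.card_sum] at h4
    have h5 : Module.finrank ℂ (LinearMap.ker
        (C - (Complex.I / 2) • (1 : Matrix (κ ⊕ κ) (κ ⊕ κ) ℂ)).mulVecLin) =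
        Module.finrank ℂ (Module.End.eigenspace (Matrix.toLin' C) (Complex.I / 2)) := by
      have hl : Matrix.toLin' C - (Complex.I / 2) • (1 : Module.End ℂ (κ ⊕ κ → ℂ)) =
          (C - (Complex.I / 2) • (1 : Matrix (κ ⊕ κ) (κ ⊕ κ) ℂ)).mulVecLin := by
        refine LinearMap.ext fun v => ?_
        simp
      rw [Module.End.eigenspace_def, hl]
    have h6 : Module.finrank ℂ (LinearMap.range
        (C - (Complex.I / 2) • (1 : Matrix (κ ⊕ κ) (κ ⊕ κ) ℂ)).mulVecLin) =
        (C - (Complex.I / 2) • (1 : Matrix (κ ⊕ κ) (κ ⊕ κ) ℂ)).rank := rfl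
    omega

end SymplecticEigenvalues

/-! ### The Weyl operators of the modes -/

section WeylOperators

variable {ι : Type} [Fintype ι]

theorem inner_weyl_weyl (z : ι ⊕ ι → ℝ) (f g : ModeSpace ι) : ⟪weyl z f, weyl z g⟫_ℂ = ⟪f, g⟫_ℂ :=
  LinearIsometry.inner_map_map _ _ _

theorem weyl_zero : weyl (0 : ι ⊕ ι → ℝ) = 1 := by
  refine ContinuousLinearMap.ext fun f => Lp.ext ?_
  filter_upwards [weyl_apply_ae 0 f] with x hx
  rw [hx]
  have : (x + fun j => (0 : ι ⊕ ι → ℝ) (Sum.inr j)) = x := by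
    ext j
    simp
  rw [this]
  simp

theorem weyl_weyl [DecidableEq ι] (z w : ι ⊕ ι → ℝ) (f : ModeSpace ι) :
    weyl z (weyl w f) = cocycle (sympForm ι) z w • weyl (z + w) f := by
  refine Lp.ext ?_
  filter_upwards [weyl_apply_ae z (weyl w f),
    (measurePreserving_add_right (volume : Measure (ι → ℝ))
      (fun j => z (.inr j))).quasiMeasurePreserving.ae (weyl_apply_ae w f),
    weyl_apply_ae (z + w) f, Lp.coeFn_smul (cocycle (sympForm ι) z w) (weyl (z + w) f)]
    with x h1 h2 h3 h4
  rw [h4, Pi.smul_apply, h1, h2, h3, smul_eq_mul, ← mul_assoc, ← mul_assoc, cocycle,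
    ← Complex.exp_add, ← Complex.exp_add]
  have e1 : ((x + fun j => z (Sum.inr j)) + fun j => w (Sum.inr j)) =
      x + fun j => (z + w) (Sum.inr j) := by
    rw [add_assoc]
    rfl
  rw [e1]
  congr 2
  have e2 : z ⬝ᵥ sympForm ι *ᵥ w =
      ∑ j, (z (.inl j) * w (.inr j) - z (.inr j) * w (.inl j)) := by
    simp [sympForm, dotProduct, Matrix.fromBlocks_mulVec, Finset.sum_add_distrib, sub_eq_add_neg,
      Matrix.neg_mulVec]
  rw [e2, ← add_mul, ← Complex.ofReal_add, ← neg_mul, ← add_mul]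
  congr 1
  rw [← Complex.ofReal_ofNat, ← Complex.ofReal_div, ← Complex.ofReal_neg, ← Complex.ofReal_add]
  congr 1
  rw [← Finset.sum_add_distrib, Finset.sum_div, ← Finset.sum_neg_distrib, ← Finset.sum_add_distrib]
  refine Finset.sum_congr rfl fun j _ => ?_
  simp only [Pi.add_apply]
  ring

theorem isWeylSystem_weyl [DecidableEq ι] : IsWeylSystem (sympForm ι) (weyl (ι := ι)) where
  skew := sympForm_transpose
  zero := weyl_zero
  mul := weyl_weyl
  adjoint z := by
    symm
    rw [ContinuousLinearMap.eq_adjoint_iff]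
    intro f g
    have h : weyl z (weyl (-z) f) = f := by
      rw [weyl_weyl, add_neg_cancel, weyl_zero, cocycle, Matrix.mulVec_neg, dotProduct_neg,
        skew_dotProduct_self sympForm_transpose]
      simp
    conv_rhs => rw [← h, inner_weyl_weyl]

theorem IsWeylSystem.comp_transpose {I J : Type} [Fintype I] [Fintype J] {H : Type*}
    [NormedAddCommGroup H] [InnerProductSpace ℂ H] [CompleteSpace H] {D : Matrix I I ℝ}
    {A : (I → ℝ) → H →L[ℂ] H} (h : IsWeylSystem D A) (K : Matrix J I ℝ) :
    IsWeylSystem (K * D * Kᵀ) (fun z => A (Kᵀ *ᵥ z)) where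
  skew := by
    simp [Matrix.transpose_mul, h.skew, Matrix.mul_assoc]
  zero := by
    rw [Matrix.mulVec_zero, h.zero]
  mul z w x := by
    rw [h.mul, Matrix.mulVec_add, cocycle, cocycle]
    congr 6
    rw [← Matrix.mulVec_mulVec, ← Matrix.mulVec_mulVec, Matrix.dotProduct_mulVec z,
      ← Matrix.mulVec_transpose]
  adjoint z := by
    rw [h.adjoint, Matrix.mulVec_neg]

theorem isWeylSystem_one {I : Type} [Fintype I] (H : Type*) [NormedAddCommGroup H]
    [InnerProductSpace ℂ H] [CompleteSpace H] :
    IsWeylSystem (0 : Matrix I I ℝ) (fun _ => (1 : H →L[ℂ] H)) where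
  skew := by simp
  zero := rfl
  mul z w x := by simp [cocycle]
  adjoint _ := star_one (H →L[ℂ] H)

end WeylOperators

/-! ### Countable direct sums of a Hilbert space -/

section DirectSums

variable {H : Type*} [NormedAddCommGroup H] [InnerProductSpace ℂ H]

/-- The operator `1 ⊗ X` on `ℓ²(ℕ) ⊗ H`, acting on all components of a sequence. -/
def seqMap (X : H →L[ℂ] H) : lp (fun _ : ℕ => H) 2 →L[ℂ] lp (fun _ : ℕ => H) 2 :=
  lp.mapCLM 2 (fun _ : ℕ => X) (norm_nonneg X) (fun _ => le_rfl)

theorem seqMap_apply (X : H →L[ℂ] H) (x : lp (fun _ : ℕ => H) 2) (k : ℕ) :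
    seqMap X x k = X (x k) := by
  rw [seqMap, lp.mapCLM_apply_coe]

theorem adjoint_seqMap [CompleteSpace H] (X : H →L[ℂ] H) :
    ContinuousLinearMap.adjoint (seqMap X) = seqMap (ContinuousLinearMap.adjoint X) := by
  symm
  rw [ContinuousLinearMap.eq_adjoint_iff]
  intro x y
  simp only [lp.inner_eq_tsum, seqMap_apply, ContinuousLinearMap.adjoint_inner_left]

theorem IsWeylSystem.seqMap [CompleteSpace H] {I : Type} [Fintype I] {D : Matrix I I ℝ}
    {A : (I → ℝ) → H →L[ℂ] H} (h : IsWeylSystem D A) :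
    IsWeylSystem D (fun z => Bosonic.seqMap (A z)) where
  skew := h.skew
  zero := by
    refine ContinuousLinearMap.ext fun x => lp.ext (funext fun k => ?_)
    rw [seqMap_apply, h.zero]
    rfl
  mul z w x := by
    refine lp.ext (funext fun k => ?_)
    rw [seqMap_apply, seqMap_apply, h.mul, lp.coeFn_smul, Pi.smul_apply, seqMap_apply]
  adjoint z := by
    rw [adjoint_seqMap, h.adjoint]

/-- An operator on `ℓ²(ℕ) ⊗ H` whose commutant contains `1 ⊗ A` for an irreducible family of
operators `A` on `H` commutes with all operators `1 ⊗ X`. -/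
theorem commute_seqMap_of_irreducible {S : Set (H →L[ℂ] H)}
    (hS : ∀ T : H →L[ℂ] H, (∀ A ∈ S, ∀ x, T (A x) = A (T x)) → ∃ c : ℂ, ∀ x, T x = c • x)
    {T : lp (fun _ : ℕ => H) 2 →L[ℂ] lp (fun _ : ℕ => H) 2}
    (hT : ∀ A ∈ S, ∀ x, T (seqMap A x) = seqMap A (T x)) (X : H →L[ℂ] H)
    (x : lp (fun _ : ℕ => H) 2) : T (seqMap X x) = seqMap X (T x) := by
  have hsingle : ∀ (Y : H →L[ℂ] H) (k : ℕ) (y : H),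
      seqMap Y (lp.single 2 k y) = lp.single 2 k (Y y) := by
    intro Y k y
    refine lp.ext (funext fun l => ?_)
    rw [seqMap_apply]
    by_cases h : l = k
    · subst h
      simp
    · simp [h]
  have hcomp : ∀ (k l : ℕ) (y : H), T (lp.single 2 k (X y)) l = X (T (lp.single 2 k y) l) := by
    intro k l
    let e : H →L[ℂ] H := (lp.evalCLM ℂ (fun _ : ℕ => H) 2 l) ∘L T ∘L
      (lp.singleContinuousLinearMap ℂ (fun _ : ℕ => H) 2 k)
    have he : ∀ y, e y = T (lp.single 2 k y) l := fun y => rfl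
    obtain ⟨c, hc⟩ := hS e fun A hA y => by
      rw [he, he, ← hsingle, hT A hA, seqMap_apply]
    intro y
    rw [← he, ← he, hc, hc, map_smul]
  have h2 : ∀ k y, T (seqMap X (lp.single 2 k y)) = seqMap X (T (lp.single 2 k y)) := by
    intro k y
    refine lp.ext (funext fun l => ?_)
    rw [hsingle, seqMap_apply, hcomp]
  have hsum := lp.hasSum_single (E := fun _ : ℕ => H) (p := 2) (by simp) x
  have h3 := hsum.mapL (T ∘L seqMap X)
  have h4 := hsum.mapL (seqMap X ∘L T)
  have h5 : (fun k => (T ∘L seqMap X) (lp.single 2 k (x k))) =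
      fun k => (seqMap X ∘L T) (lp.single 2 k (x k)) := funext fun k => h2 k _
  rw [h5] at h3
  exact h3.unique h4

end DirectSums

/-! ### Irreducibility of the Weyl operators -/

section Irreducibility

variable {ι : Type} [Fintype ι]

/-- Injectivity of the Fourier transform on real integrable functions. -/
theorem ae_eq_zero_of_fourier_real {u : (ι → ℝ) → ℝ} (hu : Integrable u)
    (h : ∀ a : ι → ℝ, ∫ x, Complex.exp ((a ⬝ᵥ x : ℝ) * Complex.I) * (u x : ℂ) = 0) :
    u =ᵐ[volume] 0 := by
  classical
  have hfin : ∀ w : (ι → ℝ) → ℝ, Integrable w → ∫⁻ x, ENNReal.ofReal (w x) ≠ ⊤ := by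
    intro w hw
    exact (hw.lintegral_lt_top).ne
  have hu' : Integrable (fun x => -u x) := hu.neg
  have : IsFiniteMeasure ((volume : Measure (ι → ℝ)).withDensity fun x => ENNReal.ofReal (u x)) :=
    isFiniteMeasure_withDensity (hfin _ hu)
  have : IsFiniteMeasure ((volume : Measure (ι → ℝ)).withDensity fun x => ENNReal.ofReal (-u x)) :=
    isFiniteMeasure_withDensity (hfin _ hu')
  have hint : ∀ (w : (ι → ℝ) → ℝ), Integrable w → ∀ a : ι → ℝ, Integrable fun x =>
      (ENNReal.ofReal (w x)).toReal • Complex.exp ((a ⬝ᵥ x : ℝ) * Complex.I) := by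
    intro w hw a
    refine Integrable.mono hw.norm (AEStronglyMeasurable.fun_smul ?_ ?_) (ae_of_all _ fun x => ?_)
    · exact hw.1.aemeasurable.ennreal_ofReal.ennreal_toReal.aestronglyMeasurable
    · refine Continuous.aestronglyMeasurable ?_
      unfold dotProduct
      fun_prop
    · rw [norm_smul, Complex.norm_exp_ofReal_mul_I, mul_one, norm_norm, Real.norm_eq_abs,
        Real.norm_eq_abs, ENNReal.toReal_ofReal', abs_of_nonneg (le_max_right _ _)]
      exact max_le (le_abs_self _) (abs_nonneg _)
  have hmeas : (volume : Measure (ι → ℝ)).withDensity (fun x => ENNReal.ofReal (u x)) =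
      (volume : Measure (ι → ℝ)).withDensity (fun x => ENNReal.ofReal (-u x)) := by
    refine Measure.ext_of_charFunDual (funext fun L => ?_)
    have hL : ∀ x, L x = (fun j => L (Pi.single j 1)) ⬝ᵥ x := by
      intro x
      have h2 := LinearMap.pi_apply_eq_sum_univ (L : (ι → ℝ) →ₗ[ℝ] ℝ) x
      refine h2.trans (Finset.sum_congr rfl fun j _ => ?_)
      rw [smul_eq_mul, mul_comm]
      have e1 : (fun k => if j = k then (1 : ℝ) else 0) = Pi.single j 1 := by
        ext k
        simp [Pi.single_apply, eq_comm]
      rw [e1]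
      rfl
    generalize (fun j => L (Pi.single j 1)) = a at hL
    rw [charFunDual_apply, charFunDual_apply,
      integral_withDensity_eq_integral_toReal_smul₀ hu.1.aemeasurable.ennreal_ofReal
        (ae_of_all _ fun _ => ENNReal.ofReal_lt_top),
      integral_withDensity_eq_integral_toReal_smul₀ hu'.1.aemeasurable.ennreal_ofReal
        (ae_of_all _ fun _ => ENNReal.ofReal_lt_top), ← sub_eq_zero]
    simp only [hL]
    rw [← integral_sub (hint _ hu a) (hint _ hu' a), ← h a]
    refine integral_congr_ae (ae_of_all _ fun x => ?_)
    simp only [ENNReal.toReal_ofReal', ← sub_smul]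
    rw [Complex.real_smul, mul_comm]
    congr 2
    rcases le_total 0 (u x) with h0 | h0
    · rw [max_eq_left h0, max_eq_right (by linarith)]
      ring
    · rw [max_eq_right h0, max_eq_left (by linarith)]
      ring
  rw [withDensity_eq_iff hu.1.aemeasurable.ennreal_ofReal hu'.1.aemeasurable.ennreal_ofReal
    (hfin _ hu)] at hmeas
  filter_upwards [hmeas] with x hx
  rcases le_total 0 (u x) with h0 | h0
  · rw [ENNReal.ofReal_of_nonpos (by linarith : -u x ≤ 0), ENNReal.ofReal_eq_zero] at hx
    exact le_antisymm hx h0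
  · rw [ENNReal.ofReal_of_nonpos h0, eq_comm, ENNReal.ofReal_eq_zero] at hx
    exact le_antisymm h0 (neg_nonpos.1 hx)

/-- Injectivity of the Fourier transform on integrable functions. -/
theorem ae_eq_zero_of_fourier {k : (ι → ℝ) → ℂ} (hk : Integrable k)
    (h : ∀ a : ι → ℝ, ∫ x, Complex.exp ((a ⬝ᵥ x : ℝ) * Complex.I) * k x = 0) :
    k =ᵐ[volume] 0 := by
  have hre : ∀ k : (ι → ℝ) → ℂ, Integrable k →
      (∀ a : ι → ℝ, ∫ x, Complex.exp ((a ⬝ᵥ x : ℝ) * Complex.I) * k x = 0) →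
      (fun x => (k x).re) =ᵐ[volume] 0 := by
    intro k hk h
    refine ae_eq_zero_of_fourier_real hk.re fun a => ?_
    have hc : ∫ x, Complex.exp ((a ⬝ᵥ x : ℝ) * Complex.I) * (starRingEnd ℂ) (k x) = 0 := by
      have h1 := congrArg (starRingEnd ℂ) (h (-a))
      rw [← integral_conj, map_zero] at h1
      refine Eq.trans (integral_congr_ae (ae_of_all _ fun x => ?_)) h1
      simp only [map_mul, ← Complex.exp_conj, Complex.conj_ofReal, Complex.conj_I, neg_dotProduct]
      push_cast
      ring_nf
    have hI : ∀ q : (ι → ℝ) → ℂ, Integrable q →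
        Integrable fun x => Complex.exp ((a ⬝ᵥ x : ℝ) * Complex.I) * q x := by
      intro q hq
      refine hq.bdd_mul (c := 1) ?_ (ae_of_all _ fun x => (Complex.norm_exp_ofReal_mul_I _).le)
      refine Continuous.aestronglyMeasurable ?_
      unfold dotProduct
      fun_prop
    have h2 : ∀ x, Complex.exp ((a ⬝ᵥ x : ℝ) * Complex.I) * ((k x).re : ℂ) =
        (1 / 2) * (Complex.exp ((a ⬝ᵥ x : ℝ) * Complex.I) * k x +
          Complex.exp ((a ⬝ᵥ x : ℝ) * Complex.I) * (starRingEnd ℂ) (k x)) := by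
      intro x
      rw [← mul_add, Complex.add_conj]
      push_cast
      ring
    have hkc : Integrable fun x => (starRingEnd ℂ) (k x) := by
      have := Complex.conjCLE.toContinuousLinearMap.integrable_comp hk
      exact this
    simp only [h2]
    rw [integral_const_mul, integral_add (hI _ hk) (hI _ hkc), h, hc]
    simp
  have h1 := hre k hk h
  have h2 := hre (fun x => -Complex.I * k x) (hk.const_mul _) fun a => by
    have h3 : ∀ x, Complex.exp ((a ⬝ᵥ x : ℝ) * Complex.I) * (-Complex.I * k x) =
      -Complex.I * (Complex.exp ((a ⬝ᵥ x : ℝ) * Complex.I) * k x) := fun x => by ring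
    simp only [h3]
    rw [integral_const_mul, h, mul_zero]
  filter_upwards [h1, h2] with x hx1 hx2
  refine Complex.ext hx1 ?_
  simpa using hx2

/-- A measurable function that is almost everywhere invariant under each translation is almost
everywhere constant. -/
theorem ae_eq_const_of_translation_invariant {m : (ι → ℝ) → ℂ} (hm : Measurable m)
    (h : ∀ b : ι → ℝ, ∀ᵐ x : ι → ℝ, m (x + b) = m x) : ∃ c, ∀ᵐ x : ι → ℝ, m x = c := by
  have hset : MeasurableSet {p : (ι → ℝ) × (ι → ℝ) | m (p.2 + p.1) = m p.2} :=
    measurableSet_eq_fun (hm.comp (measurable_snd.add measurable_fst)) (hm.comp measurable_snd)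
  have h1 : ∀ᵐ x : ι → ℝ, ∀ᵐ b : ι → ℝ, m (x + b) = m x :=
    (Measure.ae_ae_comm (p := fun b x => m (x + b) = m x) hset).1 (ae_of_all _ h)
  obtain ⟨x, hx⟩ := h1.exists
  refine ⟨m x, ?_⟩
  have h2 :=
    (measurePreserving_add_left (volume : Measure (ι → ℝ)) (-x)).quasiMeasurePreserving.ae hx
  filter_upwards [h2] with y hy
  rwa [add_neg_cancel_left] at hy

/-- The Weyl operators act irreducibly. An operator commuting with the multiplications by
`exp(i a·x)` is a multiplication operator, by injectivity of the Fourier transform, and its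
multiplier is translation invariant. -/
theorem exists_eq_smul_of_commute_weyl {T : ModeOp ι}
    (hT : ∀ z f, T (weyl z f) = weyl z (T f)) : ∃ c : ℂ, ∀ f, T f = c • f := by
  have hmul : ∀ f g : ModeSpace ι,
      ∀ᵐ x : ι → ℝ, f x * starRingEnd ℂ (ContinuousLinearMap.adjoint T g x) =
        T f x * starRingEnd ℂ (g x) := by
    intro f g
    have hi1 := L2.integrable_inner (𝕜 := ℂ) (ContinuousLinearMap.adjoint T g) f
    have hi2 := L2.integrable_inner (𝕜 := ℂ) g (T f)
    have h0 := ae_eq_zero_of_fourier (hi1.sub hi2) fun a => ?_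
    · filter_upwards [h0] with x hx
      simp only [Pi.sub_apply, RCLike.inner_apply, Pi.zero_apply] at hx
      exact sub_eq_zero.1 hx
    · have hw : ∀ f : ModeSpace ι, ∀ᵐ x : ι → ℝ, weyl (Sum.elim a 0) f x =
          Complex.exp ((a ⬝ᵥ x : ℝ) * Complex.I) * f x := by
        intro f
        filter_upwards [weyl_apply_ae (Sum.elim a 0) f] with x hx
        rw [hx]
        have e1 : (x + fun j => (Sum.elim a 0 : ι ⊕ ι → ℝ) (Sum.inr j)) = x := by
          ext j
          simp
        rw [e1]
        simp [dotProduct]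
      have hint : ∀ f g : ModeSpace ι, ⟪f, weyl (Sum.elim a 0) g⟫_ℂ =
          ∫ x, Complex.exp ((a ⬝ᵥ x : ℝ) * Complex.I) * ⟪f x, g x⟫_ℂ := by
        intro f g
        rw [L2.inner_def]
        refine integral_congr_ae ?_
        filter_upwards [hw g] with x hx
        rw [hx]
        simp only [RCLike.inner_apply]
        ring
      have hI : ∀ q : (ι → ℝ) → ℂ, Integrable q →
          Integrable fun x => Complex.exp ((a ⬝ᵥ x : ℝ) * Complex.I) * q x := by
        intro q hq
        refine hq.bdd_mul (c := 1) ?_ (ae_of_all _ fun x => (Complex.norm_exp_ofReal_mul_I _).le)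
        refine Continuous.aestronglyMeasurable ?_
        unfold dotProduct
        fun_prop
      simp only [Pi.sub_apply, mul_sub]
      rw [integral_sub (hI _ hi1) (hI _ hi2), ← hint, ← hint,
        ContinuousLinearMap.adjoint_inner_left, hT, sub_self]
  -- a square integrable function without zeros
  obtain ⟨p, hp0, hpm, hp⟩ := exists_pos_lintegral_lt_of_sigmaFinite
    (volume : Measure (ι → ℝ)) (one_ne_zero (α := ℝ≥0∞))
  have hq : MemLp (fun x => ((√(p x : ℝ) : ℝ) : ℂ)) 2 (volume : Measure (ι → ℝ)) := by
    have hm : AEStronglyMeasurable (fun x => ((√(p x : ℝ) : ℝ) : ℂ))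
        (volume : Measure (ι → ℝ)) := by
      fun_prop
    rw [memLp_two_iff_integrable_sq_norm hm]
    have h1 : ∀ x, ‖((√(p x : ℝ) : ℝ) : ℂ)‖ ^ 2 = (p x : ℝ) := by
      intro x
      rw [Complex.norm_real, Real.norm_eq_abs, sq_abs, Real.sq_sqrt (NNReal.coe_nonneg _)]
    simp only [h1]
    refine ⟨by fun_prop, ?_⟩
    rw [hasFiniteIntegral_iff_enorm]
    refine lt_of_eq_of_lt (lintegral_congr fun x => ?_) (hp.trans ENNReal.one_lt_top)
    rw [Real.enorm_of_nonneg (NNReal.coe_nonneg _), ENNReal.ofReal_coe_nnreal]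
  let φ : ModeSpace ι := hq.toLp _
  have hφ : ∀ᵐ x : ι → ℝ, φ x = ((√(p x : ℝ) : ℝ) : ℂ) := MemLp.coeFn_toLp hq
  have hr : ∀ x, ((√(p x : ℝ) : ℝ) : ℂ) ≠ 0 := fun x => by
    have := Real.sqrt_pos.2 (NNReal.coe_pos.2 (hp0 x))
    exact_mod_cast this.ne'
  -- the multiplier of `T`
  let m : (ι → ℝ) → ℂ := fun x => T φ x / ((√(p x : ℝ) : ℝ) : ℂ)
  have hm : Measurable m := (Lp.stronglyMeasurable (T φ)).measurable.div (by fun_prop)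
  have hTm : ∀ f : ModeSpace ι, ∀ᵐ x : ι → ℝ, T f x = m x * f x := by
    intro f
    filter_upwards [hmul f φ, hmul φ φ, hφ] with x h1 h2 h3
    rw [h3] at h1 h2
    rw [Complex.conj_ofReal] at h1 h2
    have h4 : starRingEnd ℂ (ContinuousLinearMap.adjoint T φ x) = T φ x := by
      rw [mul_comm] at h2
      exact mul_right_cancel₀ (hr x) h2
    rw [h4] at h1
    simp only [m]
    field_simp [hr x]
    rw [mul_comm (T φ x), h1]
  obtain ⟨c, hc⟩ := ae_eq_const_of_translation_invariant hm fun b => by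
    have hw : ∀ f : ModeSpace ι, ∀ᵐ x : ι → ℝ, weyl (Sum.elim 0 b) f x = f (x + b) := by
      intro f
      filter_upwards [weyl_apply_ae (Sum.elim 0 b) f] with x hx
      rw [hx]
      simp only [Sum.elim_inl, Sum.elim_inr, Pi.zero_apply, zero_mul, Finset.sum_const_zero,
        Complex.ofReal_zero, Complex.exp_zero, one_mul]
    have hs := (measurePreserving_add_right (volume : Measure (ι → ℝ)) b).quasiMeasurePreserving
    have heq : T (weyl (Sum.elim 0 b) φ) = weyl (Sum.elim 0 b) (T φ) := hT _ _
    filter_upwards [hTm (weyl (Sum.elim 0 b) φ), hw φ, hw (T φ), hs.ae hφ] with x h1 h2 h3 h4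
    rw [heq, h3, h2, h4] at h1
    simp only [m]
    rw [h1]
    simp only [m]
    field_simp [hr (x + b)]
  refine ⟨c, fun f => Lp.ext ?_⟩
  filter_upwards [hTm f, hc, Lp.coeFn_smul c f] with x h1 h2 h3
  rw [h1, h2, h3]
  rfl

end Irreducibility

/-! ### Density operators as mixtures of pure states -/

section Mixtures

variable {H : Type*} [NormedAddCommGroup H] [InnerProductSpace ℂ H]

/-- The operator `∑ k, |x_k⟩⟨x_k|`. It is used for square summable families, for which the series
converges in norm; it has the junk value `0` if the series is not summable. -/
def mixture {K : Type*} (x : K → H) : H →L[ℂ] H :=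
  ∑' k, InnerProductSpace.rankOne ℂ (x k) (x k)

theorem norm_inner_mul_inner_le (a b e : H) :
    ‖⟪a, e⟫_ℂ * ⟪e, b⟫_ℂ‖ ≤ ‖⟪e, a⟫_ℂ‖ ^ 2 + ‖⟪e, b⟫_ℂ‖ ^ 2 := by
  rw [norm_mul, norm_inner_symm a e]
  nlinarith [sq_nonneg (‖⟪e, a⟫_ℂ‖ - ‖⟪e, b⟫_ℂ‖), sq_nonneg (‖⟪e, a⟫_ℂ‖ + ‖⟪e, b⟫_ℂ‖)]

theorem hasSum_norm_inner_sq {β : Type*} (e : HilbertBasis β ℂ H) (a : H) :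
    HasSum (fun i => ‖⟪e i, a⟫_ℂ‖ ^ 2) (‖a‖ ^ 2) := by
  have h := e.hasSum_inner_mul_inner a a
  rw [inner_self_eq_norm_sq_to_K] at h
  have h2 := (Complex.hasSum_re h)
  convert h2 using 1
  · ext i
    rw [← inner_conj_symm a, Complex.conj_mul', ← Complex.ofReal_pow, Complex.ofReal_re]
  · change ‖a‖ ^ 2 = ((‖a‖ : ℂ) ^ 2).re
    rw [← Complex.ofReal_pow, Complex.ofReal_re]

theorem rankOne_eq_mixture (ψ : H) :
    InnerProductSpace.rankOne ℂ ψ ψ = mixture fun _ : Unit => ψ := by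
  rw [mixture, tsum_fintype]
  simp

variable [CompleteSpace H] {K : Type*} {x : K → H}

theorem summable_rankOne (hx : Summable fun k => ‖x k‖ ^ 2) :
    Summable fun k => InnerProductSpace.rankOne ℂ (x k) (x k) := by
  refine Summable.of_norm ?_
  simpa [InnerProductSpace.norm_rankOne, sq] using hx

theorem hasSum_mixture_apply (hx : Summable fun k => ‖x k‖ ^ 2) (y : H) :
    HasSum (fun k => ⟪x k, y⟫_ℂ • x k) (mixture x y) :=
  (summable_rankOne hx).hasSum.mapL (ContinuousLinearMap.apply ℂ H y)

/-- The trace of `(∑ k, |x_k⟩⟨x_k|) W` is `∑ k, ⟨x_k, W x_k⟩`. -/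
theorem hasSum_inner_mixture {β : Type*} (e : HilbertBasis β ℂ H)
    (hx : Summable fun k => ‖x k‖ ^ 2) (W : H →L[ℂ] H) :
    HasSum (fun i => ⟪e i, mixture x (W (e i))⟫_ℂ) (∑' k, ⟪x k, W (x k)⟫_ℂ) := by
  let F : K × β → ℂ := fun q =>
    ⟪ContinuousLinearMap.adjoint W (x q.1), e q.2⟫_ℂ * ⟪e q.2, x q.1⟫_ℂ
  have hFs : Summable F := by
    refine Summable.of_norm_bounded (g := fun q => ‖⟪e q.2,
      ContinuousLinearMap.adjoint W (x q.1)⟫_ℂ‖ ^ 2 + ‖⟪e q.2, x q.1⟫_ℂ‖ ^ 2) ?_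
      fun q => norm_inner_mul_inner_le _ _ _
    have h1 : ∀ k, HasSum (fun i => ‖⟪e i, ContinuousLinearMap.adjoint W (x k)⟫_ℂ‖ ^ 2 +
        ‖⟪e i, x k⟫_ℂ‖ ^ 2) (‖ContinuousLinearMap.adjoint W (x k)‖ ^ 2 + ‖x k‖ ^ 2) :=
      fun k => (hasSum_norm_inner_sq e _).add (hasSum_norm_inner_sq e _)
    rw [summable_prod_of_nonneg fun q => by positivity]
    refine ⟨fun k => (h1 k).summable, ?_⟩
    simp only [(h1 _).tsum_eq]
    refine Summable.add ?_ hx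
    refine Summable.of_nonneg_of_le (fun k => by positivity) (fun k => ?_)
      (hx.mul_left (‖ContinuousLinearMap.adjoint W‖ ^ 2))
    rw [← mul_pow]
    gcongr
    exact ContinuousLinearMap.le_opNorm _ _
  have hk : ∀ k, HasSum (fun i => F (k, i)) ⟪x k, W (x k)⟫_ℂ := by
    intro k
    have := e.hasSum_inner_mul_inner (ContinuousLinearMap.adjoint W (x k)) (x k)
    rwa [ContinuousLinearMap.adjoint_inner_left] at this
  have hi : ∀ i, HasSum (fun k => F (k, i)) ⟪e i, mixture x (W (e i))⟫_ℂ := by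
    intro i
    have := (hasSum_mixture_apply hx (W (e i))).mapL (innerSL ℂ (e i))
    simpa only [innerSL_apply_apply, inner_smul_right, F, ContinuousLinearMap.adjoint_inner_left]
      using this
  have h1 := hFs.hasSum.prod_fiberwise hk
  have h2 := ((Equiv.prodComm _ _).hasSum_iff.2 hFs.hasSum).prod_fiberwise
    (f := F ∘ (Equiv.prodComm β K)) (fun i => hi i)
  rwa [h1.tsum_eq]

theorem isPositive_mixture : (mixture x).IsPositive := by
  have h0 : (0 : H →L[ℂ] H) ≤ mixture x := tsum_nonneg fun k =>
    (ContinuousLinearMap.nonneg_iff_isPositive _).2 (InnerProductSpace.isPositive_rankOne_self _)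
  exact (ContinuousLinearMap.nonneg_iff_isPositive _).1 h0

/-- The square root of a positive operator, with its commutant. -/
theorem exists_sqrt {T : H →L[ℂ] H} (hT : 0 ≤ T) :
    ∃ S : H →L[ℂ] H, (∀ u v, ⟪S u, v⟫_ℂ = ⟪u, S v⟫_ℂ) ∧ (∀ u, S (S u) = T u) ∧
      ∀ B : H →L[ℂ] H, (∀ u, T (B u) = B (T u)) → ∀ u, S (B u) = B (S u) := by
  refine ⟨CFC.sqrt T, (IsSelfAdjoint.of_nonneg (CFC.sqrt_nonneg T)).isSymmetric, fun u =>
    congrArg (fun S : H →L[ℂ] H => S u) (CFC.sqrt_mul_sqrt_self T hT), fun B hB u => ?_⟩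
  have hc : Commute T B := ContinuousLinearMap.ext hB
  have := hc.cfcₙ_nnreal NNReal.sqrt
  exact congrArg (fun S : H →L[ℂ] H => S u) this

/-- A positive operator with finite trace is a mixture of the vectors `√ρ e_i`. -/
theorem exists_eq_mixture {β : Type*} (e : HilbertBasis β ℂ H) {ρ : H →L[ℂ] H} (h0 : 0 ≤ ρ)
    (h1 : Summable fun i => ⟪e i, ρ (e i)⟫_ℂ) :
    ∃ x : β → H, (Summable fun i => ‖x i‖ ^ 2) ∧ ρ = mixture x := by
  obtain ⟨S, hsa, hss, -⟩ := exists_sqrt h0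
  have hx : Summable fun i => ‖S (e i)‖ ^ 2 := by
    refine (Complex.hasSum_re h1.hasSum).summable.congr fun i => ?_
    rw [← hss, ← hsa, inner_self_eq_norm_sq_to_K]
    change ((‖S (e i)‖ : ℂ) ^ 2).re = _
    rw [← Complex.ofReal_pow, Complex.ofReal_re]
  refine ⟨_, hx, ContinuousLinearMap.ext fun y => ?_⟩
  have h2 := (e.hasSum_repr (S y)).mapL S
  rw [hss] at h2
  refine h2.unique ?_
  convert! hasSum_mixture_apply hx y using 2 with i
  rw [map_smul, e.repr_apply_apply, hsa]

end Mixtures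

section DensityOperators

variable {ι : Type} [Fintype ι] {K : Type*} {x : K → ModeSpace ι}

theorem charFn_mixture (hx : Summable fun k => ‖x k‖ ^ 2) (z : ι ⊕ ι → ℝ) :
    charFn (mixture x) z = ∑' k, ⟪x k, weyl z (x k)⟫_ℂ :=
  (hasSum_inner_mixture (basis ι) hx (weyl z)).tsum_eq

theorem isDensityOperator_mixture (hx : HasSum (fun k => ‖x k‖ ^ 2) 1) :
    IsDensityOperator (mixture x) := by
  refine ⟨isPositive_mixture, ?_⟩
  · have h := hasSum_inner_mixture (basis ι) hx.summable (1 : ModeOp ι)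
    have h2 : ∑' k, ⟪x k, (1 : ModeOp ι) (x k)⟫_ℂ = 1 := by
      have h3 : ∀ k, ⟪x k, (1 : ModeOp ι) (x k)⟫_ℂ = ((‖x k‖ ^ 2 : ℝ) : ℂ) := fun k => by
        rw [one_apply_eq_self, inner_self_eq_norm_sq_to_K, Complex.ofReal_pow]
        rfl
      simp only [h3]
      rw [← Complex.ofReal_tsum, hx.tsum_eq, Complex.ofReal_one]
    rw [h2] at h
    exact h

theorem isDensityOperator_rankOne {ψ : ModeSpace ι} (h : ‖ψ‖ = 1) :
    IsDensityOperator (InnerProductSpace.rankOne ℂ ψ ψ) := by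
  rw [rankOne_eq_mixture]
  refine isDensityOperator_mixture ?_
  simp [h]

theorem charFn_rankOne (ψ : ModeSpace ι) (z : ι ⊕ ι → ℝ) :
    charFn (InnerProductSpace.rankOne ℂ ψ ψ) z = ⟪ψ, weyl z ψ⟫_ℂ := by
  rw [rankOne_eq_mixture, charFn_mixture (Summable.of_finite), tsum_fintype]
  simp

/-- Every density operator is a norm convergent mixture of pure states. -/
theorem IsDensityOperator.exists_eq_mixture {ρ : ModeOp ι} (h : IsDensityOperator ρ) :
    ∃ x : basisIndex ι → ModeSpace ι, (Summable fun i => ‖x i‖ ^ 2) ∧ ρ = mixture x :=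
  Bosonic.exists_eq_mixture (basis ι) ((ContinuousLinearMap.nonneg_iff_isPositive ρ).2 h.1)
    h.2.summable

end DensityOperators

/-! ### Channels on mixtures -/

section ChannelMixtures

variable {ι : Type} [Fintype ι]

theorem comp_rankOne_comp_adjoint {ι' : Type} [Fintype ι'] (V : ModeSpace ι →L[ℂ] ModeSpace ι')
    (x : ModeSpace ι) :
    V ∘L InnerProductSpace.rankOne ℂ x x ∘L ContinuousLinearMap.adjoint V =
      InnerProductSpace.rankOne ℂ (V x) (V x) := by
  refine ContinuousLinearMap.ext fun y => ?_
  simp [ContinuousLinearMap.adjoint_inner_right]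

namespace QuantumChannel

theorem apply_rankOne (Φ : QuantumChannel ι) (f : ModeSpace ι) :
    Φ.apply (InnerProductSpace.rankOne ℂ f f) = mixture fun k => Φ.kraus k f := by
  simp only [apply, mixture, comp_rankOne_comp_adjoint]

theorem hasSum_apply_mixture (Φ : QuantumChannel ι) {K : Type*} {x : K → ModeSpace ι}
    (hx : Summable fun i => ‖x i‖ ^ 2) :
    HasSum (fun i => Φ.apply (InnerProductSpace.rankOne ℂ (x i) (x i))) (Φ.apply (mixture x)) := by
  let F : ℕ × K → ModeOp ι := fun q =>
    InnerProductSpace.rankOne ℂ (Φ.kraus q.1 (x q.2)) (Φ.kraus q.1 (x q.2))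
  have hF : Summable F := by
    rw [← (Equiv.prodComm K ℕ).summable_iff]
    refine Summable.of_norm ?_
    have h1 : ∀ q : K × ℕ, ‖(F ∘ Equiv.prodComm K ℕ) q‖ = ‖Φ.kraus q.2 (x q.1)‖ ^ 2 := fun q => by
      simp [F, InnerProductSpace.norm_rankOne, sq]
    simp only [h1]
    rw [summable_prod_of_nonneg fun q => by positivity]
    refine ⟨fun i => (Φ.complete (x i)).summable, ?_⟩
    simpa only [(Φ.complete _).tsum_eq] using hx
  have hk : ∀ k, HasSum (fun i => F (k, i))
      (Φ.kraus k ∘L mixture x ∘L ContinuousLinearMap.adjoint (Φ.kraus k)) := by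
    intro k
    have h1 := ((summable_rankOne hx).hasSum.mapL ((ContinuousLinearMap.compL ℂ (ModeSpace ι)
      (ModeSpace ι) (ModeSpace ι)).flip (ContinuousLinearMap.adjoint (Φ.kraus k)))).mapL
      (ContinuousLinearMap.compL ℂ (ModeSpace ι) (ModeSpace ι) (ModeSpace ι) (Φ.kraus k))
    convert! h1 using 2 with i
    exact (comp_rankOne_comp_adjoint (Φ.kraus k) (x i)).symm
  have hi : ∀ i, HasSum (fun k => F (k, i))
      (Φ.apply (InnerProductSpace.rankOne ℂ (x i) (x i))) := by
    intro i
    rw [apply_rankOne]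
    exact (summable_rankOne (Φ.complete (x i)).summable).hasSum
  have h1 := hF.hasSum.prod_fiberwise hk
  have h2 := ((Equiv.prodComm _ _).hasSum_iff.2 hF.hasSum).prod_fiberwise
    (f := F ∘ (Equiv.prodComm K ℕ)) (fun i => hi i)
  have h3 : Φ.apply (mixture x) = ∑' q, F q := h1.tsum_eq
  rwa [h3]

/-- A convex decomposition of a channel on pure states extends to all density operators. -/
theorem apply_eq_of_rankOne {Φ Φ₁ Φ₂ : QuantumChannel ι} {a b : ℂ}
    (h : ∀ f, Φ.apply (InnerProductSpace.rankOne ℂ f f) =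
      a • Φ₁.apply (InnerProductSpace.rankOne ℂ f f) +
        b • Φ₂.apply (InnerProductSpace.rankOne ℂ f f)) {ρ : ModeOp ι}
    (hρ : IsDensityOperator ρ) : Φ.apply ρ = a • Φ₁.apply ρ + b • Φ₂.apply ρ := by
  obtain ⟨x, hx, rfl⟩ := hρ.exists_eq_mixture
  have h1 := Φ.hasSum_apply_mixture hx
  simp only [h] at h1
  exact h1.unique (((Φ₁.hasSum_apply_mixture hx).const_smul a).add
    ((Φ₂.hasSum_apply_mixture hx).const_smul b))

end QuantumChannel

end ChannelMixtures

/-! ### Isometries into direct sums -/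

section Isometries

theorem hasSum_norm_sq {K : Type*} {H : Type*} [NormedAddCommGroup H]
    (w : lp (fun _ : K => H) 2) : HasSum (fun k => ‖w k‖ ^ 2) (‖w‖ ^ 2) := by
  simpa using lp.hasSum_norm (p := 2) (by norm_num) w

variable {H H' : Type*} [NormedAddCommGroup H] [InnerProductSpace ℂ H]
  [NormedAddCommGroup H'] [InnerProductSpace ℂ H']

/-- Operators `X_k` with `∑ k, X_k† X_k = 1`, as the isometry `x ↦ (X_k x)_k` into the direct
sum. -/
def seqIsometry (X : ℕ → H →L[ℂ] H') (hX : ∀ x, HasSum (fun k => ‖X k x‖ ^ 2) (‖x‖ ^ 2)) :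
    H →ₗᵢ[ℂ] lp (fun _ : ℕ => H') 2 where
  toFun x := ⟨fun k => X k x, (memℓp_gen_iff (by norm_num)).2 (by simpa using (hX x).summable)⟩
  map_add' x y := lp.ext (funext fun k => map_add (X k) x y)
  map_smul' c x := lp.ext (funext fun k => map_smul (X k) c x)
  norm_map' x := by
    rw [← sq_eq_sq₀ (norm_nonneg _) (norm_nonneg _), ← (hX x).tsum_eq]
    have h := lp.norm_rpow_eq_tsum (p := 2) (by norm_num) (⟨fun k => X k x,
      (memℓp_gen_iff (by norm_num)).2 (by simpa using (hX x).summable)⟩ : lp (fun _ : ℕ => H') 2)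
    simpa using h

theorem inner_seqMap (X : H →L[ℂ] H) (w : lp (fun _ : ℕ => H) 2) :
    ⟪w, seqMap X w⟫_ℂ = ∑' k, ⟪w k, X (w k)⟫_ℂ := by
  simp only [lp.inner_eq_tsum, seqMap_apply]

/-- The matrix elements of a mixture are the expectations of the operators `1 ⊗ |y⟩⟨x|` in the
direct sum. -/
theorem inner_mixture_apply [CompleteSpace H] (w : lp (fun _ : ℕ => H) 2) (x y : H) :
    ⟪x, mixture w y⟫_ℂ = ⟪w, seqMap (InnerProductSpace.rankOne ℂ y x) w⟫_ℂ := by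
  rw [inner_seqMap]
  refine (((hasSum_mixture_apply (hasSum_norm_sq w).summable y).mapL
    (innerSL ℂ x)).tsum_eq.symm).trans (tsum_congr fun k => ?_)
  rw [innerSL_apply_apply, inner_smul_right, InnerProductSpace.rankOne_apply, inner_smul_right,
    mul_comm]

/-- Bounded operators are determined by their expectations in unit vectors, by polarization. -/
theorem eq_of_inner_unit {X Y : H →L[ℂ] H} (h : ∀ f, ‖f‖ = 1 → ⟪f, X f⟫_ℂ = ⟪f, Y f⟫_ℂ) :
    X = Y := by
  have h1 : ∀ f, ⟪f, X f⟫_ℂ = ⟪f, Y f⟫_ℂ := by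
    intro f
    rcases eq_or_ne f 0 with rfl | hf
    · simp
    · have h2 := h ((‖f‖⁻¹ : ℂ) • f) (norm_smul_inv_norm hf)
      have h3 : (‖f‖ : ℂ) ≠ 0 := by simpa using hf
      simpa only [map_smul, inner_smul_left, inner_smul_right, map_inv₀, Complex.conj_ofReal,
        mul_right_inj' (inv_ne_zero h3)] using h2
  refine ContinuousLinearMap.coe_injective ((ext_inner_map _ _).1 fun f => ?_)
  change ⟪X f, f⟫_ℂ = ⟪Y f, f⟫_ℂ
  rw [← inner_conj_symm, h1, inner_conj_symm]

end Isometries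

/-! ### Minimal noise -/

section Minimality

open scoped ComplexOrder

variable {ι : Type} [Fintype ι] {H₀ : Type} {H : Type*}
  [NormedAddCommGroup H₀] [InnerProductSpace ℂ H₀] [CompleteSpace H₀]
  [NormedAddCommGroup H] [InnerProductSpace ℂ H] [CompleteSpace H]
  {D D' α : Matrix (ι ⊕ ι) (ι ⊕ ι) ℝ} {d : ι ⊕ ι → ℝ}
  {A : (ι ⊕ ι → ℝ) → H →L[ℂ] H} {U : (ι ⊕ ι → ℝ) → H₀ →L[ℂ] H₀} {V : H₀ →L[ℂ] H}

/-- An extreme Gaussian intertwiner has minimal noise: the rank of `α + ½ i (D - D')` is at most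
the number of modes. Extremality enters as the hypothesis that the operators `0 ≤ T ≤ 1` in the
commutant of the Weyl operators do not decompose `V† A(z) V`. -/
theorem rank_le_of_intertwiner [DecidableEq ι] [Nontrivial H₀] (hα : α.IsSymm)
    (hA : IsWeylSystem D A) (hU : IsWeylSystem D' U)
    (hV : ∀ z f f', ⟪V f, A z (V f')⟫_ℂ = gaussianFn d α z * ⟪f, U z f'⟫_ℂ)
    (hext : ∀ T : H →L[ℂ] H, 0 ≤ T → T ≤ 1 → (∀ z x, T (A z x) = A z (T x)) →
      ∀ p : ℝ, 0 < p → p < 1 → (∀ f, ⟪V f, T (V f)⟫_ℂ = p * ⟪V f, V f⟫_ℂ) →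
        ∀ z f, ‖f‖ = 1 → ⟪V f, T (A z (V f))⟫_ℂ = p * ⟪V f, A z (V f)⟫_ℂ) :
    2 * (hermMatrix α (D - D')).rank ≤ Fintype.card (ι ⊕ ι) := by
  by_contra! hr
  obtain ⟨lam, hlam0, hlam⟩ :=
    exists_sub_vecMulVec_posSemidef (posSemidef_of_intertwiner hα hA hU hV) hr
  obtain ⟨T, hT0, hT1, hTA, hT⟩ := exists_commutant_of_intertwiner hα hA hU hV lam hlam
  have he : Real.exp (-1 / 2) < 1 := Real.exp_lt_one_iff.2 (by norm_num)
  have he0 := Real.exp_pos (-1 / 2)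
  -- the value at `z = 0` of the factor `½ (1 + exp(-½) cosh(λ·z))` is the weight `p`; extremality
  -- would make this factor constant, but it is not at `z = λ`
  have h1 := hext T hT0 hT1 hTA ((1 + Real.exp (-1 / 2)) / 2) (by positivity) (by linarith)
    (fun f => by
      have h2 := hT 0 f f
      have h3 := hV 0 f f
      rw [hA.zero, one_apply_eq_self] at h2 h3
      rw [h2, h3]
      simp [mul_assoc]) lam
  have hz : U lam = 0 := by
    refine eq_of_inner_unit fun f hf => ?_
    have h2 := h1 f hf
    rw [hT, hV] at h2
    have h3 : gaussianFn d α lam ≠ 0 := Complex.exp_ne_zero _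
    by_contra h4
    rw [zero_apply, inner_zero_right] at h4
    rw [mul_assoc] at h2
    have h5 := mul_right_cancel₀ (mul_ne_zero h3 h4) h2
    have h6 : Real.cosh (lam ⬝ᵥ lam) = 1 := by
      have h7 := Complex.ofReal_injective h5
      have h8 : Real.exp (-1 / 2) * Real.cosh (lam ⬝ᵥ lam) = Real.exp (-1 / 2) * 1 := by linarith
      exact mul_left_cancel₀ he0.ne' h8
    have h9 : lam ⬝ᵥ lam ≠ 0 := fun h => hlam0 (dotProduct_self_eq_zero.1 h)
    exact (Real.one_lt_cosh.2 h9).ne' h6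
  obtain ⟨f, hf⟩ := exists_ne (0 : H₀)
  have h2 := hU.neg_apply_apply lam f
  rw [hz] at h2
  simp at h2
  exact hf h2.symm

end Minimality

/-! ### Pure Gaussian states -/

section PureStates

open scoped ComplexOrder

variable {ι : Type} [Fintype ι] [DecidableEq ι]

/-- The covariance matrix of a pure Gaussian state satisfies the uncertainty relation
`σ + ½ i Δ ≥ 0`, and the rank of this matrix is at most the number of modes. -/
theorem IsGaussianState.posSemidef_and_rank_le {ρ : ModeOp ι} {m : ι ⊕ ι → ℝ}
    {σ : Matrix (ι ⊕ ι) (ι ⊕ ι) ℝ} (h : IsGaussianState ρ m σ) (hp : IsPureState ρ) :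
    (hermMatrix σ (sympForm ι)).PosSemidef ∧
      (hermMatrix σ (sympForm ι)).rank ≤ Fintype.card ι := by
  obtain ⟨ψ, hψ, rfl⟩ := hp
  -- `ψ` intertwines the trivial Weyl system on `ℂ`, and by irreducibility only scalars commute with
  -- the Weyl operators
  let V : ℂ →L[ℂ] ModeSpace ι := ContinuousLinearMap.toSpanSingleton ℂ ψ
  have hV : ∀ z f f', ⟪V f, weyl z (V f')⟫_ℂ = gaussianFn m σ z * ⟪f, (1 : ℂ →L[ℂ] ℂ) f'⟫_ℂ := by
    intro z f f'
    rw [← h.2.2 z, charFn_rankOne]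
    simp only [V, ContinuousLinearMap.toSpanSingleton_apply, map_smul, inner_smul_left,
      inner_smul_right, one_apply_eq_self, RCLike.inner_apply]
    ring
  have h1 := posSemidef_of_intertwiner h.2.1 isWeylSystem_weyl (isWeylSystem_one ℂ) hV
  have h2 := rank_le_of_intertwiner h.2.1 isWeylSystem_weyl (isWeylSystem_one ℂ) hV ?_
  · rw [sub_zero] at h1 h2
    rw [Fintype.card_sum] at h2
    exact ⟨h1, by omega⟩
  · intro T _ _ hT p _ _ hp z f _
    obtain ⟨c, hc⟩ := exists_eq_smul_of_commute_weyl hT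
    have h3 := hp 1
    have h4 : ⟪V 1, V 1⟫_ℂ ≠ 0 := by
      rw [inner_self_ne_zero]
      simp only [V, ContinuousLinearMap.toSpanSingleton_apply, one_smul]
      rintro rfl
      simp at hψ
    rw [hc, inner_smul_right] at h3
    rw [hc, inner_smul_right, mul_right_cancel₀ h4 h3]

end PureStates

/-! ### Extreme Gaussian channels -/

section ExtremeChannels

open scoped ComplexOrder

instance nontrivial_modeSpace (ι : Type) [Fintype ι] : Nontrivial (ModeSpace ι) := by
  refine ⟨indicatorConstLp 2 (measurableSet_closedBall (x := (0 : ι → ℝ)) (ε := 1))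
    measure_closedBall_lt_top.ne (1 : ℂ), 0, fun h => ?_⟩
  have h1 := congrArg norm h
  rw [norm_indicatorConstLp (by norm_num) (by norm_num)] at h1
  have h2 : 0 < volume.real (Metric.closedBall (0 : ι → ℝ) 1) :=
    ENNReal.toReal_pos (Metric.measure_closedBall_pos _ _ one_pos).ne' measure_closedBall_lt_top.ne
  have h3 := Real.rpow_pos_of_pos h2 (1 / (2 : ℝ≥0∞).toReal)
  rw [norm_one, one_mul, norm_zero] at h1
  exact h3.ne' h1

variable {ι : Type} [Fintype ι]

namespace QuantumChannel

/-- The Stinespring isometry `f ↦ (V_k f)_k` of a channel. -/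
def stinespring (Φ : QuantumChannel ι) : ModeSpace ι →ₗᵢ[ℂ] lp (fun _ : ℕ => ModeSpace ι) 2 :=
  seqIsometry Φ.kraus Φ.complete

theorem inner_apply_rankOne (Φ : QuantumChannel ι) (f x y : ModeSpace ι) :
    ⟪x, Φ.apply (InnerProductSpace.rankOne ℂ f f) y⟫_ℂ =
      ⟪Φ.stinespring f, seqMap (InnerProductSpace.rankOne ℂ y x) (Φ.stinespring f)⟫_ℂ := by
  rw [apply_rankOne, ← inner_mixture_apply]
  rfl

theorem charFn_apply_rankOne (Φ : QuantumChannel ι) (f : ModeSpace ι) (z : ι ⊕ ι → ℝ) :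
    charFn (Φ.apply (InnerProductSpace.rankOne ℂ f f)) z =
      ⟪Φ.stinespring f, seqMap (weyl z) (Φ.stinespring f)⟫_ℂ := by
  rw [apply_rankOne, charFn_mixture (Φ.complete f).summable, inner_seqMap]
  rfl

/-- The channel with a given Stinespring isometry. -/
def ofIsometry (W : ModeSpace ι →ₗᵢ[ℂ] lp (fun _ : ℕ => ModeSpace ι) 2) : QuantumChannel ι where
  kraus k := lp.evalCLM ℂ (fun _ : ℕ => ModeSpace ι) 2 k ∘L W.toContinuousLinearMap
  complete x := by
    have h := hasSum_norm_sq (W x)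
    rw [W.norm_map] at h
    exact h

/-- A positive operator in the commutant of the operators `1 ⊗ X` yields a channel, with
Stinespring isometry `√T V / √p`. -/
theorem exists_of_commutant (Φ : QuantumChannel ι)
    {T : lp (fun _ : ℕ => ModeSpace ι) 2 →L[ℂ] lp (fun _ : ℕ => ModeSpace ι) 2} (hT : 0 ≤ T)
    (hc : ∀ X w, T (seqMap X w) = seqMap X (T w)) {p : ℝ} (hp : 0 < p)
    (hTp : ∀ f, ⟪Φ.stinespring f, T (Φ.stinespring f)⟫_ℂ =
      p * ⟪Φ.stinespring f, Φ.stinespring f⟫_ℂ) :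
    ∃ Φ₁ : QuantumChannel ι, ∀ X f,
      p * ⟪Φ₁.stinespring f, seqMap X (Φ₁.stinespring f)⟫_ℂ =
        ⟪Φ.stinespring f, T (seqMap X (Φ.stinespring f))⟫_ℂ := by
  obtain ⟨S, hsa, hss, hsc⟩ := exists_sqrt hT
  let c : ℂ := ((√p : ℝ) : ℂ)⁻¹
  have hcc : (p : ℂ) * (starRingEnd ℂ c * c) = 1 := by
    have h0 : ((√p : ℝ) : ℂ) ≠ 0 := by exact_mod_cast (Real.sqrt_pos.2 hp).ne'
    have h1 : (p : ℂ) = (√p : ℝ) * (√p : ℝ) := by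
      rw [← Complex.ofReal_mul, Real.mul_self_sqrt hp.le]
    simp only [c, map_inv₀, Complex.conj_ofReal]
    rw [h1]
    field_simp
  have hkey : ∀ X f, (p : ℂ) * ⟪c • S (Φ.stinespring f), seqMap X (c • S (Φ.stinespring f))⟫_ℂ =
      ⟪Φ.stinespring f, T (seqMap X (Φ.stinespring f))⟫_ℂ := by
    intro X f
    rw [map_smul, inner_smul_left, inner_smul_right, ← mul_assoc (starRingEnd ℂ c), ← mul_assoc,
      hcc, one_mul, ← hsc _ (hc X), hsa, hss]
  let W₀ : ModeSpace ι →L[ℂ] lp (fun _ : ℕ => ModeSpace ι) 2 :=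
    c • (S ∘L Φ.stinespring.toContinuousLinearMap)
  have hW : ∀ f, ‖W₀ f‖ = ‖f‖ := by
    intro f
    have h1 : (p : ℂ) * ⟪W₀ f, W₀ f⟫_ℂ = p * ⟪f, f⟫_ℂ := by
      have h2 := hkey 1 f
      have h3 : ∀ w : lp (fun _ : ℕ => ModeSpace ι) 2, seqMap 1 w = w := fun w =>
        lp.ext (funext fun k => seqMap_apply _ _ _)
      rw [h3, h3, hTp, LinearIsometry.inner_map_map] at h2
      exact h2
    have h4 := mul_left_cancel₀ (Complex.ofReal_ne_zero.2 hp.ne') h1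
    rw [inner_self_eq_norm_sq_to_K, inner_self_eq_norm_sq_to_K] at h4
    have h5 : ‖W₀ f‖ ^ 2 = ‖f‖ ^ 2 := by exact_mod_cast h4
    exact (sq_eq_sq₀ (norm_nonneg _) (norm_nonneg _)).1 h5
  exact ⟨ofIsometry ⟨W₀.toLinearMap, hW⟩, fun X f => hkey X f⟩

/-- An extreme channel is not decomposed by operators in the commutant of the operators
`1 ⊗ X`. -/
theorem IsExtreme.inner_commutant {Φ : QuantumChannel ι} (hΦ : Φ.IsExtreme)
    {T : lp (fun _ : ℕ => ModeSpace ι) 2 →L[ℂ] lp (fun _ : ℕ => ModeSpace ι) 2} (hT0 : 0 ≤ T)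
    (hT1 : T ≤ 1) (hc : ∀ X w, T (seqMap X w) = seqMap X (T w)) {p : ℝ} (hp0 : 0 < p)
    (hp1 : p < 1) (hTp : ∀ f, ⟪Φ.stinespring f, T (Φ.stinespring f)⟫_ℂ =
      p * ⟪Φ.stinespring f, Φ.stinespring f⟫_ℂ) (z : ι ⊕ ι → ℝ) {f : ModeSpace ι}
    (hf : ‖f‖ = 1) :
    ⟪Φ.stinespring f, T (seqMap (weyl z) (Φ.stinespring f))⟫_ℂ =
      p * ⟪Φ.stinespring f, seqMap (weyl z) (Φ.stinespring f)⟫_ℂ := by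
  obtain ⟨Φ₁, h₁⟩ := Φ.exists_of_commutant hT0 hc hp0 hTp
  obtain ⟨Φ₂, h₂⟩ := Φ.exists_of_commutant (T := 1 - T) (sub_nonneg.2 hT1)
    (fun X w => by simp [sub_apply, hc, map_sub]) (sub_pos.2 hp1)
    (fun f => by
      rw [sub_apply, inner_sub_right, hTp, one_apply_eq_self]
      push_cast
      ring)
  have hsum : ∀ f, Φ.apply (InnerProductSpace.rankOne ℂ f f) =
      (p : ℂ) • Φ₁.apply (InnerProductSpace.rankOne ℂ f f) +
        ((1 - p : ℝ) : ℂ) • Φ₂.apply (InnerProductSpace.rankOne ℂ f f) := by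
    intro f
    refine ContinuousLinearMap.ext fun y => ext_inner_left ℂ fun x => ?_
    rw [add_apply, smul_apply, smul_apply, inner_add_right, inner_smul_right, inner_smul_right,
      inner_apply_rankOne, inner_apply_rankOne, inner_apply_rankOne, h₁, h₂, sub_apply,
      one_apply_eq_self, inner_sub_right, add_sub_cancel]
  have heq := hΦ Φ₁ Φ₂ p hp0 hp1 (fun ρ hρ => apply_eq_of_rankOne hsum hρ)
    _ (isDensityOperator_rankOne hf)
  have h3 : Φ.apply (InnerProductSpace.rankOne ℂ f f) =
      Φ₁.apply (InnerProductSpace.rankOne ℂ f f) := by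
    rw [hsum, ← heq, ← add_smul, ← Complex.ofReal_add, add_sub_cancel, Complex.ofReal_one, one_smul]
  rw [← h₁, ← charFn_apply_rankOne, ← charFn_apply_rankOne, h3]

/-- The Gaussian action on characteristic functions in the Heisenberg picture:
`∑ k, V_k† W(z) V_k = exp(-½ zᵀ α z + i d·z) W(Kᵀ z)`. -/
theorem inner_stinespring {Φ : QuantumChannel ι} {K α : Matrix (ι ⊕ ι) (ι ⊕ ι) ℝ}
    {d : ι ⊕ ι → ℝ} (h : ∀ ρ : ModeOp ι, IsDensityOperator ρ → ∀ z : ι ⊕ ι → ℝ,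
      charFn (Φ.apply ρ) z = charFn ρ (Kᵀ *ᵥ z) * gaussianFn d α z) (z : ι ⊕ ι → ℝ)
    (f f' : ModeSpace ι) :
    ⟪Φ.stinespring f, seqMap (weyl z) (Φ.stinespring f')⟫_ℂ =
      gaussianFn d α z * ⟪f, weyl (Kᵀ *ᵥ z) f'⟫_ℂ := by
  have h1 : ContinuousLinearMap.adjoint Φ.stinespring.toContinuousLinearMap ∘L
      seqMap (weyl z) ∘L Φ.stinespring.toContinuousLinearMap =
      gaussianFn d α z • weyl (Kᵀ *ᵥ z) := by
    refine eq_of_inner_unit fun f hf => ?_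
    rw [ContinuousLinearMap.comp_apply, ContinuousLinearMap.adjoint_inner_right, smul_apply,
      inner_smul_right, mul_comm, ← charFn_rankOne, ← h _ (isDensityOperator_rankOne hf),
      charFn_apply_rankOne]
    rfl
  have h2 := congrArg (fun X : ModeOp ι => ⟪f, X f'⟫_ℂ) h1
  simp only [ContinuousLinearMap.comp_apply, ContinuousLinearMap.adjoint_inner_right, smul_apply,
    inner_smul_right] at h2
  exact h2

/-- The noise of an extreme Gaussian channel is minimal: `α + ½ i (Δ - K Δ Kᵀ) ≥ 0`, and the rank
of this matrix is at most the number of modes. -/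
theorem IsExtreme.posSemidef_and_rank_le [DecidableEq ι] {Φ : QuantumChannel ι} (hΦ : Φ.IsExtreme)
    {K α : Matrix (ι ⊕ ι) (ι ⊕ ι) ℝ} {d : ι ⊕ ι → ℝ} (hα : α.IsSymm)
    (h : ∀ ρ : ModeOp ι, IsDensityOperator ρ → ∀ z : ι ⊕ ι → ℝ,
      charFn (Φ.apply ρ) z = charFn ρ (Kᵀ *ᵥ z) * gaussianFn d α z) :
    (hermMatrix α (sympForm ι - K * sympForm ι * Kᵀ)).PosSemidef ∧
      (hermMatrix α (sympForm ι - K * sympForm ι * Kᵀ)).rank ≤ Fintype.card ι := by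
  have hV := inner_stinespring h
  have hA := (isWeylSystem_weyl (ι := ι)).seqMap
  have hU := (isWeylSystem_weyl (ι := ι)).comp_transpose K
  refine ⟨posSemidef_of_intertwiner (V := Φ.stinespring.toContinuousLinearMap) hα hA hU hV, ?_⟩
  have h2 := rank_le_of_intertwiner (V := Φ.stinespring.toContinuousLinearMap) hα hA hU hV ?_
  · rw [Fintype.card_sum] at h2
    omega
  · intro T hT0 hT1 hT p hp0 hp1 hTp z f hf
    refine hΦ.inner_commutant hT0 hT1 (fun X w => ?_) hp0 hp1 hTp z hf
    refine commute_seqMap_of_irreducible (S := Set.range (weyl (ι := ι))) (fun Y hY => ?_) ?_ X w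
    · exact exists_eq_smul_of_commute_weyl fun z f => hY _ ⟨z, rfl⟩ f
    · rintro _ ⟨z, rfl⟩ x
      exact hT z x

end QuantumChannel

end ExtremeChannels

/-! ### Weyl operators and product vectors -/

section WeylTensor

variable {κ ι : Type} [Fintype κ] [Fintype ι]

theorem quasiMeasurePreserving_fst_split : Measure.QuasiMeasurePreserving
    (fun (x : κ ⊕ ι → ℝ) (k : κ) => x (.inl k)) volume volume :=
  Measure.quasiMeasurePreserving_fst.comp measurePreserving_split.quasiMeasurePreserving

theorem quasiMeasurePreserving_snd_split : Measure.QuasiMeasurePreserving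
    (fun (x : κ ⊕ ι → ℝ) (j : ι) => x (.inr j)) volume volume :=
  Measure.quasiMeasurePreserving_snd.comp measurePreserving_split.quasiMeasurePreserving

theorem weyl_tensor (z : (κ ⊕ ι) ⊕ (κ ⊕ ι) → ℝ) (f : ModeSpace κ) (g : ModeSpace ι) :
    weyl z (tensor f g) =
      tensor (weyl (z ∘ Sum.map .inl .inl) f) (weyl (z ∘ Sum.map .inr .inr) g) := by
  refine Lp.ext ?_
  filter_upwards [weyl_apply_ae z (tensor f g),
    (measurePreserving_add_right (volume : Measure (κ ⊕ ι → ℝ))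
      (fun j => z (.inr j))).quasiMeasurePreserving.ae (tensor_apply_ae f g),
    tensor_apply_ae (weyl (z ∘ Sum.map .inl .inl) f) (weyl (z ∘ Sum.map .inr .inr) g),
    quasiMeasurePreserving_fst_split.ae (weyl_apply_ae (z ∘ Sum.map .inl .inl) f),
    quasiMeasurePreserving_snd_split.ae (weyl_apply_ae (z ∘ Sum.map .inr .inr) g)]
    with x h1 h2 h3 h4 h5
  rw [h1, h2, h3, h4, h5, mul_mul_mul_comm, ← Complex.exp_add, ← add_mul, ← Complex.ofReal_add,
    Fintype.sum_sum_type]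
  rfl

/-- The product vectors are total: the orthogonal projection onto their complement commutes with
all Weyl operators, hence is a multiple of the identity. -/
theorem eq_zero_of_inner_tensor {x : ModeSpace (κ ⊕ ι)}
    (hx : ∀ (f : ModeSpace κ) (g : ModeSpace ι), ⟪tensor f g, x⟫_ℂ = 0) : x = 0 := by
  classical
  let N : Submodule ℂ (ModeSpace (κ ⊕ ι)) :=
    (Submodule.span ℂ (Set.range fun q : ModeSpace κ × ModeSpace ι => tensor q.1 q.2))ᗮ
  have hN : ∀ y, y ∈ N ↔ ∀ (f : ModeSpace κ) (g : ModeSpace ι), ⟪tensor f g, y⟫_ℂ = 0 := by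
    intro y
    refine ⟨fun h f g => (Submodule.mem_orthogonal _ _).1 h _ (Submodule.subset_span ⟨(f, g), rfl⟩),
      fun h => ?_⟩
    rw [← Submodule.span_singleton_le_iff_mem, ← Submodule.isOrtho_iff_le, Submodule.isOrtho_comm,
      Submodule.isOrtho_span]
    rintro _ ⟨q, rfl⟩ v hv
    rw [Set.mem_singleton_iff] at hv
    rw [hv]
    exact h _ _
  have hadj : ∀ z (u v : ModeSpace (κ ⊕ ι)), ⟪u, weyl z v⟫_ℂ = ⟪weyl (-z) u, v⟫_ℂ := by
    intro z u v
    rw [← isWeylSystem_weyl.adjoint, ContinuousLinearMap.adjoint_inner_left]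
  have h1 : ∀ z, ∀ y ∈ N, weyl z y ∈ N := by
    intro z y hy
    rw [hN] at hy ⊢
    intro f g
    rw [hadj, weyl_tensor, hy]
  have h2 : ∀ z, ∀ y ∈ Nᗮ, weyl z y ∈ Nᗮ := by
    intro z y hy
    rw [Submodule.mem_orthogonal] at hy ⊢
    intro u hu
    rw [hadj]
    exact hy _ (h1 _ _ hu)
  obtain ⟨c, hc⟩ := exists_eq_smul_of_commute_weyl (T := N.starProjection) fun z f => by
    refine Submodule.eq_starProjection_of_mem_orthogonal (h1 _ _ (N.starProjection_apply_mem f)) ?_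
    rw [← map_sub]
    exact h2 _ _ (N.sub_starProjection_mem_orthogonal f)
  obtain ⟨f, hf⟩ := exists_ne (0 : ModeSpace κ)
  obtain ⟨g, hg⟩ := exists_ne (0 : ModeSpace ι)
  have ht : tensor f g ≠ 0 := by
    rw [← norm_ne_zero_iff, norm_tensor]
    exact mul_ne_zero (norm_ne_zero_iff.2 hf) (norm_ne_zero_iff.2 hg)
  have h3 : N.starProjection (tensor f g) = 0 := by
    rw [Submodule.starProjection_apply_eq_zero_iff, Submodule.mem_orthogonal']
    exact fun u hu => (hN u).1 hu f g
  rw [hc, smul_eq_zero_iff_left ht] at h3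
  have h4 := Submodule.starProjection_eq_self_iff.2 ((hN x).2 hx)
  rw [hc, h3, zero_smul] at h4
  exact h4.symm

theorem eq_of_inner_tensor {P Q : ModeOp (κ ⊕ ι)}
    (h : ∀ (f f' : ModeSpace κ) (g g' : ModeSpace ι),
      ⟪tensor f g, P (tensor f' g')⟫_ℂ = ⟪tensor f g, Q (tensor f' g')⟫_ℂ) : P = Q := by
  rw [← sub_eq_zero]
  have h1 : ∀ (f : ModeSpace κ) (g : ModeSpace ι), (P - Q) (tensor f g) = 0 := fun f' g' =>
    eq_zero_of_inner_tensor fun f g => by rw [sub_apply, inner_sub_right, h, sub_self]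
  have h2 : ContinuousLinearMap.adjoint (P - Q) = 0 :=
    ContinuousLinearMap.ext fun y => eq_zero_of_inner_tensor fun f g => by
      rw [ContinuousLinearMap.adjoint_inner_right, h1, inner_zero_left]
  rw [← ContinuousLinearMap.adjoint_adjoint (P - Q), h2, map_zero]

/-- As the product vectors are total, the isometry `ampIsometry κ ι` is surjective. -/
theorem ampIsometry_adjoint_apply (ψ : ModeSpace (κ ⊕ ι)) :
    ampIsometry κ ι (ContinuousLinearMap.adjoint
      (ampIsometry κ ι).toContinuousLinearMap ψ) = ψ := by
  have h : (ampIsometry κ ι).toContinuousLinearMap ∘L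
      ContinuousLinearMap.adjoint (ampIsometry κ ι).toContinuousLinearMap = 1 := by
    refine eq_of_inner_tensor fun f f' g g' => ?_
    obtain ⟨c, -, hc⟩ := exists_coords f' g'
    have h1 : ContinuousLinearMap.adjoint (ampIsometry κ ι).toContinuousLinearMap
        (ampIsometry κ ι c) = c :=
      congrArg (fun T => T c) (LinearIsometry.adjoint_comp_self (ampIsometry κ ι))
    rw [← hc, ContinuousLinearMap.comp_apply, h1]
    rfl
  exact congrArg (fun T : ModeOp (κ ⊕ ι) => T ψ) h

end WeylTensor

/-! ### Channels on one half of a composite system -/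

section Ampliation

variable {κ ι : Type} [Fintype κ] [Fintype ι]

namespace QuantumChannel

/-- The operators `1 ⊗ V_k` satisfy the completeness relation on the composite system. -/
theorem hasSum_norm_ampliation (Φ : QuantumChannel ι) (ψ : ModeSpace (κ ⊕ ι)) :
    HasSum (fun k => ‖ampliation κ (Φ.kraus k) ψ‖ ^ 2) (‖ψ‖ ^ 2) := by
  obtain ⟨c, rfl⟩ : ∃ c, ampIsometry κ ι c = ψ := ⟨_, ampIsometry_adjoint_apply ψ⟩
  let F : ℕ × basisIndex κ → ℝ := fun q => ‖Φ.kraus q.1 (c q.2)‖ ^ 2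
  have hc := hasSum_norm_sq c
  have hi : ∀ i, HasSum (fun k => F (k, i)) (‖c i‖ ^ 2) := fun i => Φ.complete (c i)
  have hF : Summable F := by
    refine (Equiv.prodComm (basisIndex κ) ℕ).summable_iff.1 ((summable_prod_of_nonneg
      fun q => sq_nonneg ‖Φ.kraus q.2 (c q.1)‖).2 ⟨fun i => (hi i).summable, ?_⟩)
    exact hc.summable.congr fun i => (hi i).tsum_eq.symm
  have hk : ∀ k, HasSum (fun i => F (k, i))
      (‖ampliation κ (Φ.kraus k) (ampIsometry κ ι c)‖ ^ 2) := by
    intro k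
    have h1 : ContinuousLinearMap.adjoint (ampIsometry κ ι).toContinuousLinearMap
        (ampIsometry κ ι c) = c :=
      congrArg (fun T => T c) (LinearIsometry.adjoint_comp_self (ampIsometry κ ι))
    have h2 : ampliation κ (Φ.kraus k) (ampIsometry κ ι c) = ampIsometry κ ι
        (lp.mapCLM 2 (fun _ : basisIndex κ => Φ.kraus k) (norm_nonneg _) (fun _ => le_rfl) c) := by
      rw [ampliation, ContinuousLinearMap.comp_apply, ContinuousLinearMap.comp_apply, h1]
      rfl
    rw [h2, LinearIsometry.norm_map]
    have h3 := hasSum_norm_sq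
      (lp.mapCLM 2 (fun _ : basisIndex κ => Φ.kraus k) (norm_nonneg _) (fun _ => le_rfl) c)
    simpa only [lp.mapCLM_apply_coe] using h3
  have h2 := ((Equiv.prodComm _ _).hasSum_iff.2 hF.hasSum).prod_fiberwise
    (f := F ∘ (Equiv.prodComm (basisIndex κ) ℕ)) (fun i => hi i)
  have h1 := hF.hasSum.prod_fiberwise hk
  rwa [h2.unique hc, ← LinearIsometry.norm_map (ampIsometry κ ι) c] at h1

/-- The Gaussian action of `1 ⊗ Φ` in the Heisenberg picture. The point `w` is `(1 ⊕ Kᵀ) z`. -/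
theorem tsum_inner_ampliation {Φ : QuantumChannel ι} {K α : Matrix (ι ⊕ ι) (ι ⊕ ι) ℝ}
    {d : ι ⊕ ι → ℝ} (h : ∀ ρ : ModeOp ι, IsDensityOperator ρ → ∀ z : ι ⊕ ι → ℝ,
      charFn (Φ.apply ρ) z = charFn ρ (Kᵀ *ᵥ z) * gaussianFn d α z)
    {z w : (κ ⊕ ι) ⊕ (κ ⊕ ι) → ℝ} (h₁ : w ∘ Sum.map .inl .inl = z ∘ Sum.map .inl .inl)
    (h₂ : w ∘ Sum.map .inr .inr = Kᵀ *ᵥ (z ∘ Sum.map .inr .inr)) (ψ : ModeSpace (κ ⊕ ι)) :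
    ∑' k, ⟪ampliation κ (Φ.kraus k) ψ, weyl z (ampliation κ (Φ.kraus k) ψ)⟫_ℂ =
      gaussianFn d α (z ∘ Sum.map .inr .inr) * ⟪ψ, weyl w ψ⟫_ℂ := by
  let V := seqIsometry (fun k => ampliation κ (Φ.kraus k)) Φ.hasSum_norm_ampliation
  have hV : ContinuousLinearMap.adjoint V.toContinuousLinearMap ∘L seqMap (weyl z) ∘L
      V.toContinuousLinearMap = gaussianFn d α (z ∘ Sum.map .inr .inr) • weyl w := by
    refine eq_of_inner_tensor fun f f' g g' => ?_
    rw [ContinuousLinearMap.comp_apply, ContinuousLinearMap.adjoint_inner_right, smul_apply,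
      inner_smul_right, ContinuousLinearMap.comp_apply, weyl_tensor, h₁, h₂, inner_tensor,
      mul_left_comm, ← inner_stinespring h, lp.inner_eq_tsum, lp.inner_eq_tsum, ← tsum_mul_left]
    refine tsum_congr fun k => ?_
    rw [seqMap_apply, seqMap_apply]
    change ⟪ampliation κ (Φ.kraus k) (tensor f g),
      weyl z (ampliation κ (Φ.kraus k) (tensor f' g'))⟫_ℂ = _
    rw [ampliation_tensor, ampliation_tensor, weyl_tensor, inner_tensor]
    rfl
  have h3 := congrArg (fun X : ModeOp (κ ⊕ ι) => ⟪ψ, X ψ⟫_ℂ) hV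
  simp only [ContinuousLinearMap.comp_apply, ContinuousLinearMap.adjoint_inner_right, smul_apply,
    inner_smul_right] at h3
  rw [← h3]
  exact (inner_seqMap (weyl z) (V ψ)).symm

theorem applySnd_rankOne (Φ : QuantumChannel ι) (ψ : ModeSpace (κ ⊕ ι)) :
    Φ.applySnd κ (InnerProductSpace.rankOne ℂ ψ ψ) =
      mixture fun k => ampliation κ (Φ.kraus k) ψ := by
  simp only [applySnd, mixture, comp_rankOne_comp_adjoint]

end QuantumChannel

end Ampliation

/-! ### Block sums of phase space matrices -/

section BlockSums

open scoped ComplexOrder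

variable {κ ι : Type} {R : Type*} [CommRing R]

/-- The direct sum `A ⊕ B` of matrices on the phase spaces of two systems, as a matrix on the
phase space of the composite system. -/
def blockSum (A : Matrix (κ ⊕ κ) (κ ⊕ κ) R) (B : Matrix (ι ⊕ ι) (ι ⊕ ι) R) :
    Matrix ((κ ⊕ ι) ⊕ (κ ⊕ ι)) ((κ ⊕ ι) ⊕ (κ ⊕ ι)) R :=
  (Matrix.fromBlocks A 0 0 B).submatrix (Equiv.sumSumSumComm κ ι κ ι)
    (Equiv.sumSumSumComm κ ι κ ι)

theorem blockSum_transpose (A : Matrix (κ ⊕ κ) (κ ⊕ κ) R) (B : Matrix (ι ⊕ ι) (ι ⊕ ι) R) :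
    (blockSum A B)ᵀ = blockSum Aᵀ Bᵀ := by
  simp [blockSum, Matrix.fromBlocks_transpose]

theorem blockSum_add (A A' : Matrix (κ ⊕ κ) (κ ⊕ κ) R) (B B' : Matrix (ι ⊕ ι) (ι ⊕ ι) R) :
    blockSum A B + blockSum A' B' = blockSum (A + A') (B + B') := by
  ext (i | i) (j | j) <;> rcases i with i | i <;> rcases j with j | j <;> simp [blockSum]

theorem blockSum_map {S : Type*} [CommRing S] (f : R →+* S) (A : Matrix (κ ⊕ κ) (κ ⊕ κ) R)
    (B : Matrix (ι ⊕ ι) (ι ⊕ ι) R) : (blockSum A B).map f = blockSum (A.map f) (B.map f) := by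
  ext (i | i) (j | j) <;> rcases i with i | i <;> rcases j with j | j <;> simp [blockSum]

theorem blockSum_smul (c : R) (A : Matrix (κ ⊕ κ) (κ ⊕ κ) R) (B : Matrix (ι ⊕ ι) (ι ⊕ ι) R) :
    c • blockSum A B = blockSum (c • A) (c • B) := by
  ext (i | i) (j | j) <;> rcases i with i | i <;> rcases j with j | j <;> simp [blockSum]

theorem sympForm_sum [DecidableEq κ] [DecidableEq ι] :
    sympForm (κ ⊕ ι) = blockSum (sympForm κ) (sympForm ι) := by
  ext (i | i) (j | j) <;> rcases i with i | i <;> rcases j with j | j <;>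
    simp [sympForm, blockSum, Matrix.one_apply]

theorem blockSum_zero_eq_mul [Fintype ι] [DecidableEq ι] (B : Matrix (ι ⊕ ι) (ι ⊕ ι) R) :
    blockSum (0 : Matrix (κ ⊕ κ) (κ ⊕ κ) R) B =
      ((Matrix.fromRows 0 1 : Matrix ((κ ⊕ κ) ⊕ (ι ⊕ ι)) (ι ⊕ ι) R) * B *
        (Matrix.fromCols 0 1 : Matrix (ι ⊕ ι) ((κ ⊕ κ) ⊕ (ι ⊕ ι)) R)).submatrix
          (Equiv.sumSumSumComm κ ι κ ι) (Equiv.sumSumSumComm κ ι κ ι) := by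
  rw [blockSum, Matrix.fromRows_mul, Matrix.fromRows_mul_fromCols]
  simp

variable [Fintype κ] [Fintype ι]

theorem blockSum_mul (A A' : Matrix (κ ⊕ κ) (κ ⊕ κ) R) (B B' : Matrix (ι ⊕ ι) (ι ⊕ ι) R) :
    blockSum A B * blockSum A' B' = blockSum (A * A') (B * B') := by
  simp [blockSum, Matrix.submatrix_mul_equiv, Matrix.fromBlocks_multiply]

theorem blockSum_mulVec_inl (A : Matrix (κ ⊕ κ) (κ ⊕ κ) R) (B : Matrix (ι ⊕ ι) (ι ⊕ ι) R)
    (z : (κ ⊕ ι) ⊕ (κ ⊕ ι) → R) :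
    (blockSum A B *ᵥ z) ∘ Sum.map .inl .inl = A *ᵥ (z ∘ Sum.map .inl .inl) := by
  ext (i | i) <;> simp [blockSum, Matrix.mulVec, dotProduct]

theorem blockSum_mulVec_inr (A : Matrix (κ ⊕ κ) (κ ⊕ κ) R) (B : Matrix (ι ⊕ ι) (ι ⊕ ι) R)
    (z : (κ ⊕ ι) ⊕ (κ ⊕ ι) → R) :
    (blockSum A B *ᵥ z) ∘ Sum.map .inr .inr = B *ᵥ (z ∘ Sum.map .inr .inr) := by
  ext (i | i) <;> simp [blockSum, Matrix.mulVec, dotProduct]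

theorem dotProduct_eq_add (z w : (κ ⊕ ι) ⊕ (κ ⊕ ι) → R) :
    z ⬝ᵥ w = (z ∘ Sum.map .inl .inl) ⬝ᵥ (w ∘ Sum.map .inl .inl) +
      (z ∘ Sum.map .inr .inr) ⬝ᵥ (w ∘ Sum.map .inr .inr) := by
  simp only [dotProduct, Fintype.sum_sum_type, Function.comp_apply, Sum.map_inl, Sum.map_inr]
  ring

theorem rank_add_le {J : Type} [Fintype J] (A B : Matrix J J ℂ) :
    (A + B).rank ≤ A.rank + B.rank := by
  refine (Submodule.finrank_mono ?_).trans (Submodule.finrank_add_le_finrank_add_finrank _ _)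
  rw [Matrix.mulVecLin_add]
  exact LinearMap.range_add_le _ _

theorem rank_blockSum_zero_le [DecidableEq ι] (B : Matrix (ι ⊕ ι) (ι ⊕ ι) ℂ) :
    (blockSum (0 : Matrix (κ ⊕ κ) (κ ⊕ κ) ℂ) B).rank ≤ B.rank := by
  rw [blockSum_zero_eq_mul, Matrix.rank_submatrix]
  exact (Matrix.rank_mul_le_left _ _).trans (Matrix.rank_mul_le_right _ _)

theorem posSemidef_blockSum_zero [DecidableEq ι] {B : Matrix (ι ⊕ ι) (ι ⊕ ι) ℂ}
    (h : B.PosSemidef) : (blockSum (0 : Matrix (κ ⊕ κ) (κ ⊕ κ) ℂ) B).PosSemidef := by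
  rw [blockSum_zero_eq_mul]
  have h1 := h.mul_mul_conjTranspose_same
    (Matrix.fromRows 0 1 : Matrix ((κ ⊕ κ) ⊕ (ι ⊕ ι)) (ι ⊕ ι) ℂ)
  rw [Matrix.conjTranspose_fromRows_eq_fromCols_conjTranspose, Matrix.conjTranspose_zero,
    Matrix.conjTranspose_one] at h1
  exact h1.submatrix _

variable [DecidableEq κ] [DecidableEq ι]

/-- The matrix `σ' + ½ i Δ` of the output covariance matrix `σ' = (1 ⊕ K) σ (1 ⊕ K)ᵀ + 0 ⊕ α`. -/
theorem hermMatrix_output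
    (σ : Matrix ((κ ⊕ ι) ⊕ (κ ⊕ ι)) ((κ ⊕ ι) ⊕ (κ ⊕ ι)) ℝ) (K α : Matrix (ι ⊕ ι) (ι ⊕ ι) ℝ) :
    hermMatrix (blockSum 1 K * σ * (blockSum 1 K)ᵀ + blockSum 0 α) (sympForm (κ ⊕ ι)) =
      (blockSum 1 K).map Complex.ofRealHom * hermMatrix σ (sympForm (κ ⊕ ι)) *
        ((blockSum 1 K).map Complex.ofRealHom)ᴴ +
      blockSum 0 (hermMatrix α (sympForm ι - K * sympForm ι * Kᵀ)) := by
  have h1 : sympForm (κ ⊕ ι) = blockSum 1 K * sympForm (κ ⊕ ι) * (blockSum 1 K)ᵀ +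
      blockSum 0 (sympForm ι - K * sympForm ι * Kᵀ) := by
    rw [sympForm_sum, blockSum_transpose, blockSum_mul, blockSum_mul, blockSum_add]
    simp
  have h2 : ((blockSum (1 : Matrix (κ ⊕ κ) (κ ⊕ κ) ℝ) K).map Complex.ofRealHom)ᴴ =
      (blockSum (1 : Matrix (κ ⊕ κ) (κ ⊕ κ) ℝ) K)ᵀ.map Complex.ofRealHom := by
    ext i j
    simp
  have h3 : ∀ {J : Type} (a w : Matrix J J ℝ), hermMatrix a w =
      a.map Complex.ofRealHom + (Complex.I / 2) • w.map Complex.ofRealHom := hermMatrix_eq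
  conv_lhs => rw [h1]
  rw [h2, h3, h3, h3]
  simp only [Matrix.map_add _ (map_add Complex.ofRealHom), Matrix.map_mul, blockSum_map,
    Matrix.map_zero _ (map_zero Complex.ofRealHom)]
  have h4 : blockSum (0 : Matrix (κ ⊕ κ) (κ ⊕ κ) ℂ) (α.map Complex.ofRealHom +
      (Complex.I / 2) • (sympForm ι - K * sympForm ι * Kᵀ).map Complex.ofRealHom) =
      blockSum 0 (α.map Complex.ofRealHom) + (Complex.I / 2) •
        blockSum 0 ((sympForm ι - K * sympForm ι * Kᵀ).map Complex.ofRealHom) := by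
    rw [blockSum_smul, blockSum_add, smul_zero, add_zero]
  rw [h4, smul_add, mul_add, add_mul, Matrix.mul_smul, Matrix.smul_mul]
  abel

end BlockSums

/-! ### The output state -/

section Output

open scoped ComplexOrder

variable {κ ι : Type} [Fintype κ] [Fintype ι] [DecidableEq κ]

/-- The Gaussian functions are transformed by `σ ↦ (1 ⊕ K) σ (1 ⊕ K)ᵀ + 0 ⊕ α`. -/
theorem gaussianFn_output (m : (κ ⊕ ι) ⊕ (κ ⊕ ι) → ℝ)
    (σ : Matrix ((κ ⊕ ι) ⊕ (κ ⊕ ι)) ((κ ⊕ ι) ⊕ (κ ⊕ ι)) ℝ) (K α : Matrix (ι ⊕ ι) (ι ⊕ ι) ℝ)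
    (d : ι ⊕ ι → ℝ) (z : (κ ⊕ ι) ⊕ (κ ⊕ ι) → ℝ) :
    gaussianFn d α (z ∘ Sum.map .inr .inr) * gaussianFn m σ ((blockSum 1 K)ᵀ *ᵥ z) =
      gaussianFn (blockSum 1 K *ᵥ m + Sum.elim (0 : κ ⊕ κ → ℝ) d ∘ Equiv.sumSumSumComm κ ι κ ι)
        (blockSum 1 K * σ * (blockSum 1 K)ᵀ + blockSum 0 α) z := by
  have h1 : z ⬝ᵥ (blockSum 1 K * σ * (blockSum 1 K)ᵀ) *ᵥ z =
      ((blockSum 1 K)ᵀ *ᵥ z) ⬝ᵥ σ *ᵥ ((blockSum 1 K)ᵀ *ᵥ z) := by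
    rw [← Matrix.mulVec_mulVec, ← Matrix.mulVec_mulVec, Matrix.dotProduct_mulVec z,
      ← Matrix.mulVec_transpose]
  have h2 : z ⬝ᵥ blockSum 0 α *ᵥ z =
      (z ∘ Sum.map .inr .inr) ⬝ᵥ α *ᵥ (z ∘ Sum.map .inr .inr) := by
    rw [dotProduct_eq_add, blockSum_mulVec_inl, blockSum_mulVec_inr, Matrix.zero_mulVec,
      dotProduct_zero, zero_add]
  have h3 : (blockSum 1 K *ᵥ m) ⬝ᵥ z = m ⬝ᵥ (blockSum 1 K)ᵀ *ᵥ z := by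
    rw [Matrix.dotProduct_mulVec, Matrix.vecMul_transpose]
  have h4 : (Sum.elim (0 : κ ⊕ κ → ℝ) d ∘ Equiv.sumSumSumComm κ ι κ ι) ⬝ᵥ z =
      d ⬝ᵥ (z ∘ Sum.map .inr .inr) := by
    simp [dotProduct, Fintype.sum_sum_type]
  simp only [gaussianFn, ← Complex.exp_add, Matrix.add_mulVec, dotProduct_add, add_dotProduct, h1,
    h2, h3, h4]
  congr 1
  push_cast
  ring

variable [DecidableEq ι]

/-- Applying an extreme Gaussian channel to one part of a pure Gaussian state. The rank of
`σ' + ½ i Δ` is at most the number of all modes plus the number of modes of the channel, which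
leaves a symplectic eigenvalue `1/2` for each of the other modes. -/
theorem QuantumChannel.IsExtreme.applySnd_isGaussianState {Φ : QuantumChannel ι}
    (hext : Φ.IsExtreme) (hgauss : Φ.IsGaussian) {ρ : ModeOp (κ ⊕ ι)}
    {m : (κ ⊕ ι) ⊕ (κ ⊕ ι) → ℝ} {σ : Matrix ((κ ⊕ ι) ⊕ (κ ⊕ ι)) ((κ ⊕ ι) ⊕ (κ ⊕ ι)) ℝ}
    (hρ : IsGaussianState ρ m σ) (hpure : IsPureState ρ) :
    ∃ (m' : (κ ⊕ ι) ⊕ (κ ⊕ ι) → ℝ) (σ' : Matrix ((κ ⊕ ι) ⊕ (κ ⊕ ι)) ((κ ⊕ ι) ⊕ (κ ⊕ ι)) ℝ),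
      IsGaussianState (Φ.applySnd κ ρ) m' σ' ∧
      (symplecticEigenvalues σ').card = Fintype.card (κ ⊕ ι) ∧
      Fintype.card κ ≤ (symplecticEigenvalues σ').count (1 / 2) := by
  obtain ⟨hS, hSr⟩ := hρ.posSemidef_and_rank_le hpure
  obtain ⟨K, α, d, hα, hΦ⟩ := hgauss
  obtain ⟨hB, hBr⟩ := hext.posSemidef_and_rank_le hα hΦ
  obtain ⟨ψ, hψ, rfl⟩ := hpure
  have hsymm : (blockSum 1 K * σ * (blockSum 1 K)ᵀ + blockSum 0 α).IsSymm := by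
    rw [Matrix.IsSymm, Matrix.transpose_add, Matrix.transpose_mul, Matrix.transpose_mul,
      Matrix.transpose_transpose, hρ.2.1.eq, blockSum_transpose 0 α, hα.eq, Matrix.transpose_zero,
      Matrix.mul_assoc]
  have hP : (hermMatrix (blockSum 1 K * σ * (blockSum 1 K)ᵀ + blockSum 0 α)
      (sympForm (κ ⊕ ι))).PosSemidef := by
    rw [hermMatrix_output]
    exact (hS.mul_mul_conjTranspose_same _).add (posSemidef_blockSum_zero hB)
  have hr : (hermMatrix (blockSum 1 K * σ * (blockSum 1 K)ᵀ + blockSum 0 α)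
      (sympForm (κ ⊕ ι))).rank ≤ Fintype.card (κ ⊕ ι) + Fintype.card ι := by
    rw [hermMatrix_output]
    refine (rank_add_le _ _).trans (add_le_add ?_ ((rank_blockSum_zero_le _).trans hBr))
    exact ((Matrix.rank_mul_le_left _ _).trans (Matrix.rank_mul_le_right _ _)).trans hSr
  obtain ⟨hcard, hcount⟩ := symplecticEigenvalues_spec hsymm hP
  refine ⟨_, _, ⟨?_, hsymm, fun z => (?_ : _ = gaussianFn (blockSum 1 K *ᵥ m +
    Sum.elim (0 : κ ⊕ κ → ℝ) d ∘ Equiv.sumSumSumComm κ ι κ ι) _ z)⟩, hcard, ?_⟩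
  · rw [QuantumChannel.applySnd_rankOne]
    refine isDensityOperator_mixture ?_
    have := Φ.hasSum_norm_ampliation ψ
    rwa [hψ, one_pow] at this
  · rw [QuantumChannel.applySnd_rankOne, charFn_mixture (Φ.hasSum_norm_ampliation ψ).summable,
      QuantumChannel.tsum_inner_ampliation (w := (blockSum 1 K)ᵀ *ᵥ z) hΦ, ← charFn_rankOne,
      hρ.2.2, gaussianFn_output]
    · rw [blockSum_transpose, blockSum_mulVec_inl, Matrix.transpose_one, Matrix.one_mulVec]
    · rw [blockSum_transpose, blockSum_mulVec_inr]
  · rw [Fintype.card_sum] at *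
    omega

end Output

end Bosonic

end

theorem mainTheorem1 (n : ℕ)
    (ρ : Bosonic.ModeOp (Fin n ⊕ Fin n))
    (m : (Fin n ⊕ Fin n) ⊕ (Fin n ⊕ Fin n) → ℝ)
    (σ : Matrix ((Fin n ⊕ Fin n) ⊕ (Fin n ⊕ Fin n)) ((Fin n ⊕ Fin n) ⊕ (Fin n ⊕ Fin n)) ℝ)
    (hρ : Bosonic.IsGaussianState ρ m σ) (hpure : Bosonic.IsPureState ρ)
    (Φ : Bosonic.QuantumChannel (Fin n)) (hgauss : Φ.IsGaussian) (hext : Φ.IsExtreme) :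
    ∃ (m' : (Fin n ⊕ Fin n) ⊕ (Fin n ⊕ Fin n) → ℝ)
      (σ' : Matrix ((Fin n ⊕ Fin n) ⊕ (Fin n ⊕ Fin n)) ((Fin n ⊕ Fin n) ⊕ (Fin n ⊕ Fin n)) ℝ),
      Bosonic.IsGaussianState (Φ.applySnd (Fin n) ρ) m' σ' ∧
      (Bosonic.symplecticEigenvalues σ').card = 2 * n ∧
      n ≤ (Bosonic.symplecticEigenvalues σ').count (1 / 2) := by
  obtain ⟨m', σ', h, hcard, hcount⟩ := hext.applySnd_isGaussianState hgauss hρ hpure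
  refine ⟨m', σ', h, ?_, ?_⟩
  · rw [hcard, Fintype.card_sum, Fintype.card_fin, two_mul]
  · rwa [Fintype.card_fin] at hcount
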